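/- Let $d\ge 1$, and let $B(x,r)$ denote the closed Euclidean ball in $\mathbb{R}^d$ with centre $x$ and radius $r$. For a Borel probability measure $\mu$ on $\mathbb{R}^d$, $x\in\operatorname{supp}\mu$, $r>0$ and $\varepsilon>0$, let $$\operatorname{por}(\mu,x,r,\varepsilon)=\sup\Big\{\alpha\ge 0:\ \inf_{B(y,\alpha r)\subset B(x,r)}\frac{\mu(B(y,\alpha r))}{\mu(B(x,r))}\le\varepsilon\Big\},$$ where the infimum is over all $y$ with $B(y,\alpha r)\subset B(x,r)$ and $\inf\emptyset=+\infty$. For $0<\alpha\le\frac12$ and $0<\eta\le 1$, the measure $\mu$ is called mean $(\alpha,\eta)$-porous if for every $\varepsilon>0$ it is mean $(\alpha,\eta,\varepsilon)$-porous, that is, $$\liminf_{n\to\infty}\frac1n\big|\{i\in\{0,\dots,n-1\}:\operatorname{por}(\mu,x,2^{-i},\varepsilon)\ge\alpha\}\big|\ge\eta\quad\text{for }\mu\text{-almost every }x.$$ The packing dimension $\dim_P\mu$ and the Hausdorff dimension $\dim_H\mu$ of $\mu$ are the $\mu$-essential suprema over $x$ of the upper and lower local dimensions $$\limsup_{r\to0}\frac{\log\mu(B(x,r))}{\log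 r}\quad\text{and}\quad\liminf_{r\to0}\frac{\log\mu(B(x,r))}{\log r},$$ respectively. **Theorem 1.1.** (i) If $0<\alpha\le\frac12$, $0<\eta\le1$ and $\mu$ is a mean $(\alpha,\eta)$-porous Borel probability measure on $\mathbb{R}^d$, then $$\dim_P\mu\le d-c_d\,\eta\,\alpha^d,\qquad c_d=\frac{2}{5\log 2\cdot 2^{4d}\cdot d^{d/2}}.$$ (ii) Apart from the value of the constant, this bound is sharp: there is a constant $c'_d>0$, depending only on $d$, such that for all $\alpha\in(0,\frac12)$ and $\eta\in(0,1]$ there is a mean $(\alpha,\eta)$-porous Borel probability measure $\mu$ on $\mathbb{R}^d$ with $$\dim_P\mu=\dim_H\mu\ge d-c'_d\,\eta\,\alpha^d.$$ -/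

import Mathlib

open MeasureTheory Filter Topology
open scoped ENNReal

noncomputable section

namespace MeanPorosity

variable {d : ℕ}

/-- `por μ x r ε`: the supremum of all `α ≥ 0` such that the infimum of
`μ (B(y, α r)) / μ (B(x, r))`, over all closed balls `B(y, α r)` contained in the closed ball
`B(x, r)`, is at most `ε`. The infimum is taken in `[0, ∞]`, so it is `∞` if there is no such
ball; in dimension at least one and for `r > 0`, the supremum is over a subset of `[0, 1]`
containing `0`. -/
def por (μ : Measure (EuclideanSpace ℝ (Fin d))) (x : EuclideanSpace ℝ (Fin d)) (r ε : ℝ) : ℝ :=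
  sSup {α : ℝ | 0 ≤ α ∧
    (⨅ (y : EuclideanSpace ℝ (Fin d))
        (_ : Metric.closedBall y (α * r) ⊆ Metric.closedBall x r),
      μ (Metric.closedBall y (α * r)) / μ (Metric.closedBall x r)) ≤ ENNReal.ofReal ε}

open Classical in
/-- The proportion of the scales `2⁻ⁱ`, `0 ≤ i < n`, at which `μ` has porosity at least `α`
around `x`, up to `ε`. -/
def porousProportion (μ : Measure (EuclideanSpace ℝ (Fin d))) (α ε : ℝ)
    (x : EuclideanSpace ℝ (Fin d)) (n : ℕ) : ℝ :=
  ((((Finset.range n).filter fun i : ℕ => α ≤ por μ x ((2 : ℝ)⁻¹ ^ i) ε).card : ℕ) : ℝ) / (n : ℝ)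

/-- `μ` is mean `(α, η, ε)`-porous. -/
def IsMeanPorousAt (μ : Measure (EuclideanSpace ℝ (Fin d))) (α η ε : ℝ) : Prop :=
  ∀ᵐ x ∂μ, η ≤ liminf (porousProportion μ α ε x) atTop

/-- `μ` is mean `(α, η)`-porous. -/
def IsMeanPorous (μ : Measure (EuclideanSpace ℝ (Fin d))) (α η : ℝ) : Prop :=
  ∀ ε : ℝ, 0 < ε → IsMeanPorousAt μ α η ε

/-- `log μ(B(x, r)) / log r` as an extended real number (for `0 < r < 1` it is `+∞` when
`μ(B(x, r)) = 0`). -/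
def logRatio (μ : Measure (EuclideanSpace ℝ (Fin d))) (x : EuclideanSpace ℝ (Fin d))
    (r : ℝ) : EReal :=
  ENNReal.log (μ (Metric.closedBall x r)) / ((Real.log r : ℝ) : EReal)

/-- The upper local dimension of `μ` at `x`. -/
def upperLocalDim (μ : Measure (EuclideanSpace ℝ (Fin d))) (x : EuclideanSpace ℝ (Fin d)) :
    EReal :=
  limsup (logRatio μ x) (𝓝[>] (0 : ℝ))

/-- The lower local dimension of `μ` at `x`. -/
def lowerLocalDim (μ : Measure (EuclideanSpace ℝ (Fin d))) (x : EuclideanSpace ℝ (Fin d)) :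
    EReal :=
  liminf (logRatio μ x) (𝓝[>] (0 : ℝ))

/-- The (upper) packing dimension of `μ`: the essential supremum of the upper local dimensions. -/
def packingDim (μ : Measure (EuclideanSpace ℝ (Fin d))) : EReal :=
  essSup (upperLocalDim μ) μ

/-- The (upper) Hausdorff dimension of `μ`: the essential supremum of the lower local
dimensions. -/
def hausdorffDim (μ : Measure (EuclideanSpace ℝ (Fin d))) : EReal :=
  essSup (lowerLocalDim μ) μ

/-- The constant `c_d = 2 / (5 log 2 · 2^{4d} · d^{d/2})`. -/
def porosityConst (d : ℕ) : ℝ :=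
  2 / (5 * Real.log 2 * (2 : ℝ) ^ (4 * d) * (d : ℝ) ^ ((d : ℝ) / 2))

end MeanPorosity

end

/-! Upper bound. Fix a dyadic lattice and call a subcell `L` levels below a cell a hole if its
relative mass is small. A superadditive weight on the dyadic tree of total mass at most one is a
competitor of `μ`: by Borel–Cantelli, at almost every point the cells of level `n` eventually have
mass at least `(n + 1)⁻²` times their weight. Two weights are used. `gainWeight` starts from the
Lebesgue share `2 ^ (-d n)`, withdraws `9/20` of the share of every hole, and returns the saving as
a factor `exp a`, with `a = 9/20 * 2 ^ (-d L)`, to everything inside the cell that has the hole; a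
point that lands in a hole pays a factor `20`. So, up to logarithmic terms, log-mass is at least `-d
n log 2` plus `a` per hole met minus `log 20` per landing. `landWeight` adds to the mass of a cell
four times the masses of the holes inside it that are still to be reached; it shows that the
frequency of landings at almost every point is arbitrarily small when the holes are light enough for
the given `L`. Since porosity holds for every `ε`, landings cost nothing in the limit.

Porosity at `x` produces a hole only where `x` is well inside its cell
(`IsCentral.mem_cells_lightHoles`). As `2` is invertible modulo `2 h + 1`, at every level almost a
proportion `2 ^ (-d)` of the translates of the lattice by multiples of `1 / (2 h + 1)` have `x`
central. By double counting, one of these finitely many translates serves that proportion of the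
porous levels below `N` (`exists_shift_card_isCentral`). The factors `9/20`, `8/9 * 2 ^ (-d)` and
`(α / (8 √d)) ^ d` multiply to `c_d α ^ d log 2`.

Sharpness. Take points with independent digits in base `2 ^ M`, restricted to a set `A` in a
proportion `θ` of the blocks and free elsewhere; counting cells gives the exact dimension. For small
`α`, `A` forbids `m` consecutive zero binary digit vectors, which empties a corner of every cell in
the restricted blocks at the cost of a bounded factor per block of length `M` comparable to `2 ^ (m
d)`. For other `α` and `η ≤ 1/2`, `A` is a single digit, so the measure looks like a point mass at
most scales of a restricted block. In the remaining case a Dirac mass suffices. -/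

noncomputable section

/-! ### The tree of dyadic indices -/

namespace MeanPorosity

variable {d : ℕ}

/-- The index of the dyadic cell `k` levels above the dyadic cell with index `z`. -/
def anc (k : ℕ) (z : Fin d → ℤ) : Fin d → ℤ := fun c => z c / 2 ^ k

@[simp] lemma anc_zero (z : Fin d → ℤ) : anc 0 z = z := by
  funext c; simp [anc]

lemma anc_anc (j k : ℕ) (z : Fin d → ℤ) : anc j (anc k z) = anc (k + j) z := by
  funext c
  simp only [anc]
  rw [Int.ediv_ediv_of_nonneg (by positivity), pow_add]

/-- The indices of the `2 ^ d` dyadic cells one level below `z`. -/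
def children (z : Fin d → ℤ) : Finset (Fin d → ℤ) :=
  Fintype.piFinset fun c => {2 * z c, 2 * z c + 1}

lemma mem_children {z z' : Fin d → ℤ} : z' ∈ children z ↔ anc 1 z' = z := by
  simp only [children, Fintype.mem_piFinset, Finset.mem_insert, Finset.mem_singleton, funext_iff,
    anc, pow_one]
  refine forall_congr' fun c => ?_
  omega

lemma card_children (z : Fin d → ℤ) : (children z).card = 2 ^ d := by
  rw [children, Fintype.card_piFinset]
  have : ∀ c, ({2 * z c, 2 * z c + 1} : Finset ℤ).card = 2 := fun c =>
    Finset.card_pair (by omega)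
  simp [this]

lemma anc_succ_of_mem_children {z z' : Fin d → ℤ} (h : z' ∈ children z) (s : ℕ) :
    anc (s + 1) z' = anc s z := by
  rw [← mem_children.1 h, anc_anc, add_comm]

lemma tsum_children (f : (Fin d → ℤ) → ℝ≥0∞) :
    ∑' z, ∑ z' ∈ children z, f z' = ∑' z', f z' := by
  have h1 : ∀ z, ∑ z' ∈ children z, f z' = ∑' z', if anc 1 z' = z then f z' else 0 := by
    intro z
    rw [tsum_eq_sum (s := children z)]
    · refine Finset.sum_congr rfl fun z' hz' => ?_
      rw [if_pos (mem_children.1 hz')]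
    · intro z' hz'
      rw [if_neg (fun h => hz' (mem_children.2 h))]
  simp_rw [h1]
  rw [ENNReal.tsum_comm]
  refine tsum_congr fun z' => ?_
  rw [tsum_eq_single (anc 1 z')]
  · simp
  · intro z hz
    rw [if_neg (fun h => hz h.symm)]

/-- A nonnegative function on dyadic cells that is superadditive with respect to passing to
children has decreasing total mass. -/
lemma tsum_le_of_superadditive (f : ℕ → (Fin d → ℤ) → ℝ) (hf : ∀ n z, 0 ≤ f n z)
    (h : ∀ n z, ∑ z' ∈ children z, f (n + 1) z' ≤ f n z) (n : ℕ) :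
    ∑' z, ENNReal.ofReal (f n z) ≤ ∑' z, ENNReal.ofReal (f 0 z) := by
  induction n with
  | zero => exact le_rfl
  | succ n ih =>
    refine le_trans ?_ ih
    rw [← tsum_children]
    refine ENNReal.tsum_le_tsum fun z => ?_
    rw [← ENNReal.ofReal_sum_of_nonneg fun z' _ => hf _ _]
    exact ENNReal.ofReal_le_ofReal (h n z)

/-! ### Hole systems and their pending weights -/

/-- A choice, for some of the dyadic cells, of a subcell `L` levels below. -/
structure HoleSystem (d L : ℕ) where
  /-- The cells for which a subcell is chosen. -/
  cells : ℕ → Set (Fin d → ℤ)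
  /-- The chosen subcell. -/
  hole : ℕ → (Fin d → ℤ) → (Fin d → ℤ)
  anc_hole : ∀ n, ∀ z ∈ cells n, anc L (hole n z) = z

namespace HoleSystem

variable {L : ℕ} (H : HoleSystem d L)

/-- The ancestor `s` levels above `z` has a hole that is contained in `z`. -/
def IsPending (s n : ℕ) (z : Fin d → ℤ) : Prop :=
  s ≤ n ∧ anc s z ∈ H.cells (n - s) ∧ anc (L - s) (H.hole (n - s) (anc s z)) = z

/-- The cell `z` is the hole of its ancestor `L` levels above. -/
def IsLanding (n : ℕ) (z : Fin d → ℤ) : Prop := H.IsPending L n z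

open Classical in
/-- The total weight of the proper ancestors of `z` whose hole is contained in `z`. -/
def pend (w : ℕ → (Fin d → ℤ) → ℝ) (n : ℕ) (z : Fin d → ℤ) : ℝ :=
  ∑ u ∈ Finset.range L,
    if H.IsPending (u + 1) n z then w (n - (u + 1)) (anc (u + 1) z) else 0

open Classical in
/-- The number of proper ancestors of `z` with a hole. -/
def cnt (n : ℕ) (z : Fin d → ℤ) : ℕ :=
  ((Finset.range n).filter fun j => anc (n - j) z ∈ H.cells j).card

open Classical in
/-- The number of proper ancestors of `z` that are holes. -/
def lnd (n : ℕ) (z : Fin d → ℤ) : ℕ :=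
  ((Finset.range n).filter fun j => H.IsLanding j (anc (n - j) z)).card

open Classical in
lemma card_filter_range_succ_of_mem_children (p : ℕ → (Fin d → ℤ) → Prop) (n : ℕ)
    {z z' : Fin d → ℤ} (h : z' ∈ children z) :
    ((Finset.range (n + 1)).filter fun j => p j (anc (n + 1 - j) z')).card =
      ((Finset.range n).filter fun j => p j (anc (n - j) z)).card + if p n z then 1 else 0 := by
  have h1 : ∀ j ∈ Finset.range n, p j (anc (n + 1 - j) z') ↔ p j (anc (n - j) z) := by
    intro j hj
    have hj := Finset.mem_range.1 hj
    rw [show n + 1 - j = (n - j) + 1 by omega, anc_succ_of_mem_children h]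
  rw [Finset.range_add_one, Finset.filter_insert]
  have h2 : anc (n + 1 - n) z' = z := by
    rw [show n + 1 - n = 1 by omega]; exact mem_children.1 h
  rw [h2, Finset.filter_congr h1]
  split_ifs with h3
  · rw [Finset.card_insert_of_notMem (by simp)]
  · rfl

open Classical in
lemma cnt_succ (n : ℕ) {z z' : Fin d → ℤ} (h : z' ∈ children z) :
    H.cnt (n + 1) z' = H.cnt n z + if z ∈ H.cells n then 1 else 0 :=
  card_filter_range_succ_of_mem_children (fun j z => z ∈ H.cells j) n h

open Classical in
lemma lnd_succ (n : ℕ) {z z' : Fin d → ℤ} (h : z' ∈ children z) :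
    H.lnd (n + 1) z' = H.lnd n z + if H.IsLanding n z then 1 else 0 :=
  card_filter_range_succ_of_mem_children (fun j z => H.IsLanding j z) n h

@[simp] lemma cnt_zero (z : Fin d → ℤ) : H.cnt 0 z = 0 := by simp [cnt]
@[simp] lemma lnd_zero (z : Fin d → ℤ) : H.lnd 0 z = 0 := by simp [lnd]

lemma pend_zero (w : ℕ → (Fin d → ℤ) → ℝ) (z : Fin d → ℤ) : H.pend w 0 z = 0 := by
  simp [pend, IsPending]

lemma pend_nonneg {w : ℕ → (Fin d → ℤ) → ℝ} (hw : ∀ n z, 0 ≤ w n z) (n : ℕ) (z : Fin d → ℤ) :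
    0 ≤ H.pend w n z :=
  Finset.sum_nonneg fun _ _ => by split_ifs; exacts [hw _ _, le_rfl]

-- A hole that is pending in `z` but not equal to `z` is pending in exactly one child. Hence passing
-- to the children conserves the pending weight, except that `z` may open a hole of its own and a
-- hole landing at `z` stops being pending. This is the balance law behind both weights.
open Classical in
lemma sum_children_pend (w : ℕ → (Fin d → ℤ) → ℝ) (n : ℕ) (z : Fin d → ℤ) :
    ∑ z' ∈ children z, H.pend w (n + 1) z' =
      H.pend w n z + (if z ∈ H.cells n then w n z else 0)
        - (if H.IsLanding n z then w (n - L) (anc L z) else 0) := by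
  set F : ℕ → ℝ := fun u => if H.IsPending u n z then w (n - u) (anc u z) else 0 with hF
  have key : ∀ u ∈ Finset.range L, ∑ z' ∈ children z,
      (if H.IsPending (u + 1) (n + 1) z' then w (n + 1 - (u + 1)) (anc (u + 1) z') else 0)
        = F u := by
    intro u hu
    have hu := Finset.mem_range.1 hu
    have h1 : ∀ z' ∈ children z,
        (if H.IsPending (u + 1) (n + 1) z' then w (n + 1 - (u + 1)) (anc (u + 1) z') else 0) =
        if z' = anc (L - (u + 1)) (H.hole (n - u) (anc u z)) then
          (if u ≤ n ∧ anc u z ∈ H.cells (n - u) then w (n - u) (anc u z) else 0) else 0 := by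
      intro z' hz'
      simp only [IsPending, anc_succ_of_mem_children hz',
        show n + 1 - (u + 1) = n - u by omega, Nat.add_le_add_iff_right]
      by_cases h1 : u ≤ n <;> by_cases h2 : anc u z ∈ H.cells (n - u) <;>
        by_cases h3 : z' = anc (L - (u + 1)) (H.hole (n - u) (anc u z)) <;>
        simp_all [eq_comm]
    rw [Finset.sum_congr rfl h1, Finset.sum_ite_eq']
    simp only [mem_children, anc_anc, show L - (u + 1) + 1 = L - u by omega, hF, IsPending]
    by_cases h1 : u ≤ n <;> by_cases h2 : anc u z ∈ H.cells (n - u) <;>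
        by_cases h3 : anc (L - u) (H.hole (n - u) (anc u z)) = z <;> simp_all
  have h0 : F 0 = if z ∈ H.cells n then w n z else 0 := by
    simp only [hF, IsPending, anc_zero, Nat.sub_zero, Nat.zero_le, true_and]
    by_cases h : z ∈ H.cells n
    · simp [h, H.anc_hole n z h]
    · simp [h]
  have h2 := Finset.sum_range_succ F L
  have h3 := Finset.sum_range_succ' F L
  simp only [pend]
  rw [Finset.sum_comm, Finset.sum_congr rfl key, ← h0]
  change _ = ∑ u ∈ Finset.range L, F (u + 1) + F 0 - F L
  linarith

end HoleSystem

end MeanPorosity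

/-! ### Two superadditive weights on the tree -/

namespace MeanPorosity

variable {d : ℕ}

namespace HoleSystem

variable {L : ℕ} (H : HoleSystem d L)

lemma geom_sum_le_two {r : ℝ} (h0 : 0 ≤ r) (h : r ≤ 1 / 2) (L : ℕ) :
    ∑ v ∈ Finset.range L, r ^ v ≤ 2 := by
  have h1 := geom_sum_mul r L
  have h2 : 0 ≤ ∑ v ∈ Finset.range L, r ^ v := Finset.sum_nonneg fun _ _ => by positivity
  have h3 : 0 ≤ r ^ L := by positivity
  nlinarith

/-- An ancestor has at most one hole, and the shares `r ^ (level of the hole)` have distinct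
exponents at least `n`, so a geometric series bounds their sum. -/
lemma pend_geometric_le {r : ℝ} (hr0 : 0 < r) (hr : r ≤ 1 / 2) {c : ℝ} (hc : 0 ≤ c)
    (n : ℕ) (z : Fin d → ℤ) :
    H.pend (fun n _ => c * r ^ L * r ^ n) n z ≤ 2 * c * r ^ n := by
  have h1 : H.pend (fun n _ => c * r ^ L * r ^ n) n z ≤
      ∑ u ∈ Finset.range L, c * r ^ n * r ^ (L - 1 - u) := by
    refine Finset.sum_le_sum fun u hu => ?_
    have hu := Finset.mem_range.1 hu
    split_ifs with h
    · have h2 := h.1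
      change c * r ^ L * r ^ (n - (u + 1)) ≤ _
      rw [mul_assoc, mul_assoc, ← pow_add, ← pow_add,
        show L + (n - (u + 1)) = n + (L - 1 - u) by omega]
    · positivity
  rw [← Finset.mul_sum, Finset.sum_range_reflect (fun v => r ^ v)] at h1
  have h2 := geom_sum_le_two hr0.le hr L
  have h3 : 0 ≤ c * r ^ n := by positivity
  nlinarith

/-- A lower bound for the mass of the cell `z`, in which every hole around an ancestor gives a
gain and every landing in a hole gives a loss. -/
def gainWeight (m : (Fin d → ℤ) → ℝ) (r : ℝ) (n : ℕ) (z : Fin d → ℤ) : ℝ :=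
  m (anc n z) * (r ^ n - H.pend (fun n _ => 9 / 20 * r ^ L * r ^ n) n z) *
    (Real.exp (9 / 20 * r ^ L * H.cnt n z) * (1 / 20) ^ H.lnd n z)

variable {m : (Fin d → ℤ) → ℝ} {r : ℝ}

lemma le_sub_pend (hr0 : 0 < r) (hr : r ≤ 1 / 2) (n : ℕ) (z : Fin d → ℤ) :
    r ^ n / 10 ≤ r ^ n - H.pend (fun n _ => 9 / 20 * r ^ L * r ^ n) n z := by
  have := H.pend_geometric_le hr0 hr (c := 9 / 20) (by norm_num) n z
  linarith

lemma gainWeight_nonneg (hm : ∀ z, 0 ≤ m z) (hr0 : 0 < r) (hr : r ≤ 1 / 2) (n : ℕ)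
    (z : Fin d → ℤ) : 0 ≤ H.gainWeight m r n z := by
  have h1 := H.le_sub_pend hr0 hr n z
  have h2 : 0 ≤ r ^ n - H.pend (fun n _ => 9 / 20 * r ^ L * r ^ n) n z := by
    have : 0 < r ^ n := by positivity
    linarith
  have h3 := hm (anc n z)
  unfold gainWeight
  positivity

lemma gainWeight_zero (z : Fin d → ℤ) : H.gainWeight m r 0 z = m z := by
  simp [gainWeight, pend_zero]

/-- Let `u` be the share left in `z`, so `r ^ n / 10 ≤ u ≤ r ^ n`. Opening a hole withdraws `a * r ^
n ≥ a * u`, which pays for the factor `exp a` since `exp a * (1 - a) ≤ 1`. A landing returns `9/20 *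
r ^ n ≤ 4.5 * u`; the factor `1/20` absorbs this even together with `exp a ≤ 2`. -/
lemma sum_children_gainWeight_le (hL : 1 ≤ L) (hm : ∀ z, 0 ≤ m z) (hd : 1 ≤ d) (n : ℕ)
    (z : Fin d → ℤ) :
    ∑ z' ∈ children z, H.gainWeight m (2 ^ d)⁻¹ (n + 1) z' ≤ H.gainWeight m (2 ^ d)⁻¹ n z := by
  classical
  set r : ℝ := (2 ^ d)⁻¹ with hrdef
  have hr0 : 0 < r := by positivity
  have hr : r ≤ 1 / 2 := by
    rw [hrdef, one_div]
    exact inv_anti₀ (by norm_num) (by simpa using pow_le_pow_right₀ (by norm_num : (1:ℝ) ≤ 2) hd)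
  set a : ℝ := 9 / 20 * r ^ L with ha
  set u : ℝ := r ^ n - H.pend (fun n _ => a * r ^ n) n z with hu
  have ha0 : 0 ≤ a := by positivity
  have ha1 : a ≤ 9 / 40 := by
    have : r ^ L ≤ r ^ 1 := pow_le_pow_of_le_one hr0.le (by linarith) hL
    rw [pow_one] at this
    rw [ha]; linarith
  have hrn : 0 < r ^ n := by positivity
  have hu1 : r ^ n / 10 ≤ u := H.le_sub_pend hr0 hr n z
  have hu2 : u ≤ r ^ n := by
    have := H.pend_nonneg (w := fun n _ => a * r ^ n) (fun n z => by positivity) n z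
    linarith
  have key : ∑ z' ∈ children z, (r ^ (n + 1) - H.pend (fun n _ => a * r ^ n) (n + 1) z') =
      u - (if z ∈ H.cells n then a * r ^ n else 0)
        + (if H.IsLanding n z then 9 / 20 * r ^ n else 0) := by
    rw [Finset.sum_sub_distrib, Finset.sum_const, card_children, H.sum_children_pend]
    have h1 : (2 ^ d : ℕ) • r ^ (n + 1) = r ^ n := by
      rw [nsmul_eq_mul, pow_succ, hrdef]; push_cast; field_simp
    have h2 : (if H.IsLanding n z then a * r ^ (n - L) else 0) =
        (if H.IsLanding n z then 9 / 20 * r ^ n else 0) := by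
      split_ifs with h
      · have : L ≤ n := h.1
        rw [ha, mul_assoc, ← pow_add, show L + (n - L) = n by omega]
      · rfl
    rw [h1, h2, hu]; ring
  have hstep : ∀ z' ∈ children z, H.gainWeight m r (n + 1) z' =
      (m (anc n z) * (Real.exp (a * H.cnt n z) * (1 / 20) ^ H.lnd n z) *
        (Real.exp (if z ∈ H.cells n then a else 0) * (if H.IsLanding n z then 1 / 20 else 1))) *
        (r ^ (n + 1) - H.pend (fun n _ => a * r ^ n) (n + 1) z') := by
    intro z' hz'
    rw [gainWeight, anc_succ_of_mem_children hz', H.cnt_succ n hz', H.lnd_succ n hz']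
    have e1 : Real.exp (a * ((H.cnt n z + if z ∈ H.cells n then 1 else 0 : ℕ) : ℝ)) =
        Real.exp (a * H.cnt n z) * Real.exp (if z ∈ H.cells n then a else 0) := by
      rw [← Real.exp_add]; congr 1
      split_ifs <;> push_cast <;> ring
    have e2 : (1 / 20 : ℝ) ^ (H.lnd n z + if H.IsLanding n z then 1 else 0) =
        (1 / 20) ^ H.lnd n z * (if H.IsLanding n z then 1 / 20 else 1) := by
      rw [pow_add]; split_ifs <;> simp
    rw [← ha, e1, e2]; ring
  rw [Finset.sum_congr rfl hstep, ← Finset.mul_sum, key]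
  have hmain : Real.exp (if z ∈ H.cells n then a else 0) *
      (if H.IsLanding n z then 1 / 20 else 1) *
      (u - (if z ∈ H.cells n then a * r ^ n else 0)
        + (if H.IsLanding n z then 9 / 20 * r ^ n else 0)) ≤ u := by
    have he : Real.exp a * (1 - a) ≤ 1 := by
      have h1 := Real.add_one_le_exp (-a)
      have h2 : Real.exp a * Real.exp (-a) = 1 := by rw [← Real.exp_add]; simp
      have h3 := Real.exp_pos a
      nlinarith
    have he0 := Real.exp_pos a
    have he2 : Real.exp a ≤ 2 := by nlinarith
    have harn : 0 ≤ a * r ^ n := by positivity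
    by_cases hS : z ∈ H.cells n <;> by_cases hl : H.IsLanding n z <;>
      simp only [hS, hl, if_true, if_false, Real.exp_zero]
    · nlinarith
    · have : u - a * r ^ n ≤ u * (1 - a) := by nlinarith
      have h0u : 0 ≤ u := by linarith
      nlinarith
    · linarith
    · linarith
  have hpos : 0 ≤ m (anc n z) * (Real.exp (a * H.cnt n z) * (1 / 20) ^ H.lnd n z) := by
    have := hm (anc n z)
    positivity
  calc _ = m (anc n z) * (Real.exp (a * H.cnt n z) * (1 / 20) ^ H.lnd n z) *
      (Real.exp (if z ∈ H.cells n then a else 0) *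
      (if H.IsLanding n z then 1 / 20 else 1) *
      (u - (if z ∈ H.cells n then a * r ^ n else 0)
        + (if H.IsLanding n z then 9 / 20 * r ^ n else 0))) := by ring
    _ ≤ _ := mul_le_mul_of_nonneg_left hmain hpos
    _ = _ := by rw [gainWeight, ← ha, ← hu]; ring

/-- The mass of the cell `z`, increased by the number of landings in holes. -/
def landWeight (q : ℕ → (Fin d → ℤ) → ℝ) (ε : ℝ) (n : ℕ) (z : Fin d → ℤ) : ℝ :=
  (q n z + H.pend (fun n z => 4 * q (n + L) (H.hole n z)) n z) *
    ((1 + 1 / (2 * L)) ^ H.lnd n z * ((1 + 4 * ε)⁻¹) ^ n)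

variable {q : ℕ → (Fin d → ℤ) → ℝ} {ε : ℝ}

lemma le_landWeight (hq : ∀ n z, 0 ≤ q n z) (hε : 0 ≤ ε) (n : ℕ) (z : Fin d → ℤ) :
    q n z * ((1 + 1 / (2 * L)) ^ H.lnd n z * ((1 + 4 * ε)⁻¹) ^ n) ≤ H.landWeight q ε n z := by
  refine mul_le_mul_of_nonneg_right ?_ (by positivity)
  have := H.pend_nonneg (w := fun n z => 4 * q (n + L) (H.hole n z))
    (fun n z => by have := hq (n + L) (H.hole n z); positivity) n z
  linarith

lemma landWeight_nonneg (hq : ∀ n z, 0 ≤ q n z) (hε : 0 ≤ ε) (n : ℕ) (z : Fin d → ℤ) :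
    0 ≤ H.landWeight q ε n z :=
  le_trans (by have := hq n z; positivity) (H.le_landWeight hq hε n z)

lemma landWeight_zero (z : Fin d → ℤ) : H.landWeight q ε 0 z = q 0 z := by
  simp [landWeight, pend_zero]

/-- Opening a hole adds at most `4 * ε * q`, paid for by `(1 + 4 * ε)⁻¹`. A landing at `z` removes
`4 * q`. At most `L` holes are pending there, each inside `z`, so the pending weight `p` is at most
`4 * L * q`; multiplying it by `1 + 1 / (2 * L)` costs at most `2 * q`, which the removal covers. -/
lemma sum_children_landWeight_le (hL : 1 ≤ L) (hq : ∀ n z, 0 ≤ q n z)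
    (hsum : ∀ n z, ∑ z' ∈ children z, q (n + 1) z' = q n z)
    (hmono : ∀ n k z, q (n + k) z ≤ q n (anc k z))
    (hε : 0 ≤ ε) (hε1 : ε ≤ 1 / 4)
    (hhole : ∀ n, ∀ z ∈ H.cells n, q (n + L) (H.hole n z) ≤ ε * q n z)
    (n : ℕ) (z : Fin d → ℤ) :
    ∑ z' ∈ children z, H.landWeight q ε (n + 1) z' ≤ H.landWeight q ε n z := by
  classical
  set w : ℕ → (Fin d → ℤ) → ℝ := fun n z => 4 * q (n + L) (H.hole n z) with hw
  have hw0 : ∀ n z, 0 ≤ w n z := fun n z => by have := hq (n + L) (H.hole n z); positivity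
  set B : ℝ := 1 + 1 / (2 * L) with hB
  have hL' : (1 : ℝ) ≤ L := by exact_mod_cast hL
  have hB1 : 1 ≤ B := by
    have : 0 ≤ 1 / (2 * (L : ℝ)) := by positivity
    linarith
  set p := H.pend w n z with hp
  have hp0 : 0 ≤ p := H.pend_nonneg hw0 n z
  have hland : H.IsLanding n z → w (n - L) (anc L z) = 4 * q n z := by
    rintro ⟨h1, -, h3⟩
    rw [Nat.sub_self, anc_zero] at h3
    rw [hw]
    simp only [h3, show n - L + L = n by omega]
  have key : ∑ z' ∈ children z, (q (n + 1) z' + H.pend w (n + 1) z') =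
      q n z + p + (if z ∈ H.cells n then w n z else 0)
        - (if H.IsLanding n z then 4 * q n z else 0) := by
    rw [Finset.sum_add_distrib, hsum, H.sum_children_pend]
    have : (if H.IsLanding n z then w (n - L) (anc L z) else 0) =
        (if H.IsLanding n z then 4 * q n z else 0) := by
      split_ifs with h
      · exact hland h
      · rfl
    rw [this]; ring
  have hstep : ∀ z' ∈ children z, H.landWeight q ε (n + 1) z' =
      (B ^ H.lnd n z * ((1 + 4 * ε)⁻¹) ^ n *
        ((if H.IsLanding n z then B else 1) * (1 + 4 * ε)⁻¹)) *
        (q (n + 1) z' + H.pend w (n + 1) z') := by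
    intro z' hz'
    rw [landWeight, H.lnd_succ n hz']
    have e2 : B ^ (H.lnd n z + if H.IsLanding n z then 1 else 0) =
        B ^ H.lnd n z * (if H.IsLanding n z then B else 1) := by
      rw [pow_add]; split_ifs <;> simp
    rw [← hB, e2, pow_succ]; ring
  rw [Finset.sum_congr rfl hstep, ← Finset.mul_sum, key]
  have hmain : (if H.IsLanding n z then B else 1) *
      (q n z + p + (if z ∈ H.cells n then w n z else 0)
        - (if H.IsLanding n z then 4 * q n z else 0)) ≤ (1 + 4 * ε) * (q n z + p) := by
    have hqz := hq n z
    have hS : (if z ∈ H.cells n then w n z else 0) ≤ 4 * ε * q n z := by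
      split_ifs with h
      · have := hhole n z h
        simp only [hw]; linarith
      · positivity
    have hεp : 0 ≤ ε * p := by positivity
    have hεq : 0 ≤ ε * q n z := by positivity
    by_cases hl : H.IsLanding n z
    · simp only [hl, if_true]
      have hple : p ≤ 4 * L * q n z := by
        have : p ≤ ∑ u ∈ Finset.range L, 4 * q n z := by
          refine Finset.sum_le_sum fun u hu => ?_
          have hu := Finset.mem_range.1 hu
          split_ifs with h
          · obtain ⟨h1, h2, h3⟩ := h
            have := hmono n (L - (u + 1)) (H.hole (n - (u + 1)) (anc (u + 1) z))
            rw [h3, show n + (L - (u + 1)) = n - (u + 1) + L by omega] at this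
            simp only [hw]; linarith
          · positivity
        rw [Finset.sum_const, Finset.card_range, nsmul_eq_mul] at this
        linarith
      have hBp : B * p ≤ p + 2 * q n z := by
        have : 1 / (2 * (L : ℝ)) * p ≤ 2 * q n z := by
          rw [div_mul_eq_mul_div, one_mul, div_le_iff₀ (by positivity)]
          linarith
        rw [hB]; linarith
      -- By `ε ≤ 1/4` a hole opened at `z` itself weighs at most `q n z`, so `1 + 1 - 4 = -2`.
      have h5 : B * (q n z + p + (if z ∈ H.cells n then w n z else 0) - 4 * q n z) ≤
          B * (p - 2 * q n z) := by
        refine mul_le_mul_of_nonneg_left ?_ (by linarith)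
        nlinarith
      nlinarith
    · simp only [hl, if_false]
      nlinarith
  have h1 : (1 + 4 * ε)⁻¹ * ((if H.IsLanding n z then B else 1) *
      (q n z + p + (if z ∈ H.cells n then w n z else 0)
        - (if H.IsLanding n z then 4 * q n z else 0))) ≤ q n z + p := by
    rw [inv_mul_le_iff₀ (by positivity)]
    exact hmain
  calc _ = (B ^ H.lnd n z * ((1 + 4 * ε)⁻¹) ^ n) * ((1 + 4 * ε)⁻¹ *
      ((if H.IsLanding n z then B else 1) *
      (q n z + p + (if z ∈ H.cells n then w n z else 0)
        - (if H.IsLanding n z then 4 * q n z else 0)))) := by ring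
    _ ≤ _ := mul_le_mul_of_nonneg_left h1 (by positivity)
    _ = _ := by rw [landWeight, ← hB, ← hp]; ring

end HoleSystem

end MeanPorosity

/-! ### Dyadic cells in space and the Borel–Cantelli comparison -/

namespace MeanPorosity

variable {d : ℕ}

/-- The index of the dyadic cell of level `n` containing `x`, in the lattice translated by `-t`. -/
def idx (t : Fin d → ℝ) (n : ℕ) (x : EuclideanSpace ℝ (Fin d)) : Fin d → ℤ :=
  fun c => ⌊(2 : ℝ) ^ n * (x c + t c)⌋

/-- The dyadic cell of level `n` with index `z`, in the lattice translated by `-t`. -/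
def cell (t : Fin d → ℝ) (n : ℕ) (z : Fin d → ℤ) : Set (EuclideanSpace ℝ (Fin d)) :=
  idx t n ⁻¹' {z}

variable (t : Fin d → ℝ)

lemma mem_cell {n : ℕ} {z : Fin d → ℤ} {x : EuclideanSpace ℝ (Fin d)} :
    x ∈ cell t n z ↔ idx t n x = z := Iff.rfl

lemma anc_idx (k n : ℕ) (x : EuclideanSpace ℝ (Fin d)) : anc k (idx t (n + k) x) = idx t n x := by
  funext c
  simp only [anc, idx]
  have h := Int.natCast_mul_floor_div_cancel (n := 2 ^ k) (by positivity)
    ((2 : ℝ) ^ n * (x c + t c))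
  push_cast at h
  rw [← h, pow_add]
  congr 2
  ring_nf

lemma measurable_idx (n : ℕ) : Measurable (idx t n : EuclideanSpace ℝ (Fin d) → _) := by
  refine measurable_pi_lambda _ fun c => Int.measurable_floor.comp ?_
  fun_prop

lemma measurableSet_cell (n : ℕ) (z : Fin d → ℤ) : MeasurableSet (cell t n z) :=
  measurable_idx t n (measurableSet_singleton z)

lemma cell_subset_cell_anc (n k : ℕ) (z : Fin d → ℤ) : cell t (n + k) z ⊆ cell t n (anc k z) := by
  intro x hx
  rw [mem_cell] at *
  rw [← hx, anc_idx]

lemma cell_eq_biUnion_children (n : ℕ) (z : Fin d → ℤ) :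
    cell t n z = ⋃ z' ∈ children z, cell t (n + 1) z' := by
  ext x
  simp only [Set.mem_iUnion, mem_cell, exists_prop, mem_children, exists_eq_right', anc_idx]

lemma pairwise_disjoint_cell (n : ℕ) : Pairwise (Function.onFun Disjoint (cell t n)) :=
  fun _ _ h => Disjoint.preimage _ (by simpa using h)

variable (μ : Measure (EuclideanSpace ℝ (Fin d))) [IsProbabilityMeasure μ]

lemma sum_children_measureReal_cell (n : ℕ) (z : Fin d → ℤ) :
    ∑ z' ∈ children z, μ.real (cell t (n + 1) z') = μ.real (cell t n z) := by
  rw [cell_eq_biUnion_children, measureReal_biUnion_finset]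
  · exact fun _ _ _ _ h => pairwise_disjoint_cell t (n + 1) h
  · exact fun _ _ => measurableSet_cell t _ _

lemma measureReal_cell_le_anc (n k : ℕ) (z : Fin d → ℤ) :
    μ.real (cell t (n + k) z) ≤ μ.real (cell t n (anc k z)) :=
  measureReal_mono (cell_subset_cell_anc t n k z)

lemma tsum_ofReal_measureReal_cell (n : ℕ) :
    ∑' z, ENNReal.ofReal (μ.real (cell t n z)) = 1 := by
  rw [tsum_congr fun z => ofReal_measureReal (μ := μ) (s := cell t n z), ← measure_iUnion (pairwise_disjoint_cell t n) (measurableSet_cell t n)]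
  have : ⋃ z, cell t n z = Set.univ := by
    ext x; simp [mem_cell]
  rw [this, measure_univ]

lemma ae_measureReal_cell_pos : ∀ᵐ x ∂μ, ∀ n, 0 < μ.real (cell t n (idx t n x)) := by
  refine ae_all_iff.2 fun n => ?_
  have h : μ (⋃ z ∈ {z | μ (cell t n z) = 0}, cell t n z) = 0 :=
    (measure_biUnion_null_iff (Set.to_countable _)).2 fun z hz => hz
  filter_upwards [measure_eq_zero_iff_ae_notMem.1 h] with x hx
  refine ENNReal.toReal_pos (fun h0 => hx ?_) (measure_ne_top _ _)
  simp only [Set.mem_iUnion]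
  exact ⟨idx t n x, h0, rfl⟩

/-- For a family of weights of total mass at most one, almost every point is eventually in cells
that have at least almost the mass given by the weights. -/
lemma ae_eventually_le_measureReal_cell (f : ℕ → (Fin d → ℤ) → ℝ)
    (hsum : ∀ n, ∑' z, ENNReal.ofReal (f n z) ≤ 1) :
    ∀ᵐ x ∂μ, ∀ᶠ n : ℕ in atTop,
      f n (idx t n x) ≤ ((n : ℝ) + 1) ^ 2 * μ.real (cell t n (idx t n x)) := by
  set bad : ℕ → Set (Fin d → ℤ) :=
    fun n => {z | ((n : ℝ) + 1) ^ 2 * μ.real (cell t n z) < f n z} with hbad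
  -- On bad cells `μ` is at most `(n + 1)⁻²` times the weight, whose total is at most one; the
  -- bounds are summable.
  have hB : ∀ n, μ (⋃ z ∈ bad n, cell t n z) ≤ ENNReal.ofReal (1 / ((n : ℝ) + 1) ^ 2) := by
    intro n
    have hn : (0 : ℝ) < ((n : ℝ) + 1) ^ 2 := by positivity
    calc μ (⋃ z ∈ bad n, cell t n z) ≤ ∑' z : bad n, μ (cell t n z) :=
          measure_biUnion_le μ (Set.to_countable _) _
      _ ≤ ∑' z : bad n, ENNReal.ofReal (1 / ((n : ℝ) + 1) ^ 2) * ENNReal.ofReal (f n z) := by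
          refine ENNReal.tsum_le_tsum fun z => ?_
          rw [← ENNReal.ofReal_mul (by positivity), ← ofReal_measureReal]
          refine ENNReal.ofReal_le_ofReal ?_
          have : ((n : ℝ) + 1) ^ 2 * μ.real (cell t n z) < f n z := z.2
          rw [one_div, ← div_eq_inv_mul, le_div_iff₀ hn]
          linarith
      _ ≤ ∑' z, ENNReal.ofReal (1 / ((n : ℝ) + 1) ^ 2) * ENNReal.ofReal (f n z) :=
          ENNReal.tsum_comp_le_tsum_of_injective Subtype.val_injective _
      _ ≤ ENNReal.ofReal (1 / ((n : ℝ) + 1) ^ 2) := by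
          rw [ENNReal.tsum_mul_left]
          exact mul_le_of_le_one_right (by positivity) (hsum n)
  have hfin : ∑' n, μ (⋃ z ∈ bad n, cell t n z) ≠ ∞ := by
    refine ne_top_of_le_ne_top ?_ (ENNReal.tsum_le_tsum hB)
    have hs : Summable fun n : ℕ => 1 / ((n : ℝ) + 1) ^ 2 := by
      have := (summable_nat_add_iff 1).2 (Real.summable_one_div_nat_pow.2 (le_refl 2))
      simpa using this
    rw [← ENNReal.ofReal_tsum_of_nonneg (fun n => by positivity) hs]
    exact ENNReal.ofReal_ne_top
  filter_upwards [ae_eventually_notMem hfin] with x hx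
  filter_upwards [hx] with n hn
  by_contra hlt
  refine hn ?_
  simp only [Set.mem_iUnion]
  exact ⟨idx t n x, not_le.1 hlt, rfl⟩

variable {L : ℕ} (H : HoleSystem d L)

/-- Landings in holes of small relative mass are rare. -/
lemma HoleSystem.ae_eventually_lnd_le (hL : 1 ≤ L) {ε : ℝ} (hε : 0 ≤ ε) (hε1 : ε ≤ 1 / 4)
    (hhole : ∀ n, ∀ z ∈ H.cells n,
      μ.real (cell t (n + L) (H.hole n z)) ≤ ε * μ.real (cell t n z)) :
    ∀ᵐ x ∂μ, ∀ᶠ n : ℕ in atTop, H.lnd n (idx t n x) * Real.log (1 + 1 / (2 * L)) ≤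
      4 * ε * n + 2 * Real.log (n + 1) := by
  have h0 : ∀ n z, 0 ≤ μ.real (cell t n z) := fun n z => measureReal_nonneg
  have hsum : ∀ n, ∑' z, ENNReal.ofReal (H.landWeight (fun n z => μ.real (cell t n z)) ε n z)
      ≤ 1 := by
    intro n
    refine (tsum_le_of_superadditive _ (H.landWeight_nonneg h0 hε)
      (H.sum_children_landWeight_le hL h0 (sum_children_measureReal_cell t μ)
        (measureReal_cell_le_anc t μ) hε hε1 hhole) n).trans ?_
    simp_rw [HoleSystem.landWeight_zero]
    exact (tsum_ofReal_measureReal_cell t μ 0).le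
  filter_upwards [ae_eventually_le_measureReal_cell t μ _ hsum, ae_measureReal_cell_pos t μ]
    with x hx hpos
  filter_upwards [hx] with n hn
  have h1 := (H.le_landWeight h0 hε n (idx t n x)).trans hn
  rw [mul_comm (((n : ℝ) + 1) ^ 2)] at h1
  -- The mass of the cell cancels, leaving a bound on the number of landings alone.
  have h2 := le_of_mul_le_mul_left h1 (hpos n)
  rw [inv_pow, ← div_eq_mul_inv, div_le_iff₀ (by positivity)] at h2
  have hL' : (0 : ℝ) < L := by exact_mod_cast hL
  have h3 := Real.log_le_log (by positivity) h2
  rw [Real.log_pow, Real.log_mul (by positivity) (by positivity), Real.log_pow,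
    Real.log_pow] at h3
  have h4 := Real.log_le_sub_one_of_pos (show 0 < 1 + 4 * ε by positivity)
  have h5 : (n : ℝ) * Real.log (1 + 4 * ε) ≤ n * (4 * ε) :=
    mul_le_mul_of_nonneg_left (by linarith) (by positivity)
  push_cast at h3
  linarith

/-- The mass of the cells around almost every point is bounded below in terms of the number of
holes around the point and the number of landings in holes. -/
lemma HoleSystem.ae_eventually_le_log_measureReal_cell (hL : 1 ≤ L) (hd : 1 ≤ d) :
    ∀ᵐ x ∂μ, ∃ C : ℝ, ∀ᶠ n : ℕ in atTop,
      9 / 20 * ((2 ^ d)⁻¹) ^ L * H.cnt n (idx t n x) - Real.log 20 * H.lnd n (idx t n x)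
        - d * Real.log 2 * n - 2 * Real.log (n + 1) - C ≤
      Real.log (μ.real (cell t n (idx t n x))) := by
  have h0 : ∀ z, 0 ≤ μ.real (cell t 0 z) := fun z => measureReal_nonneg
  have hr0 : (0 : ℝ) < (2 ^ d)⁻¹ := by positivity
  have hr : ((2 : ℝ) ^ d)⁻¹ ≤ 1 / 2 := by
    rw [one_div]
    exact inv_anti₀ (by norm_num) (by simpa using pow_le_pow_right₀ (by norm_num : (1:ℝ) ≤ 2) hd)
  have hsum : ∀ n, ∑' z, ENNReal.ofReal
      (H.gainWeight (fun z => μ.real (cell t 0 z)) (2 ^ d)⁻¹ n z) ≤ 1 := by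
    intro n
    refine (tsum_le_of_superadditive _ (H.gainWeight_nonneg h0 hr0 hr)
      (H.sum_children_gainWeight_le hL h0 hd) n).trans ?_
    simp_rw [HoleSystem.gainWeight_zero]
    exact (tsum_ofReal_measureReal_cell t μ 0).le
  filter_upwards [ae_eventually_le_measureReal_cell t μ _ hsum, ae_measureReal_cell_pos t μ]
    with x hx hpos
  -- `10` comes from `le_sub_pend`, the other term from the mass of the level-zero cell containing
  -- `x`.
  refine ⟨Real.log 10 - Real.log (μ.real (cell t 0 (idx t 0 x))), ?_⟩
  filter_upwards [hx] with n hn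
  have ha : anc n (idx t n x) = idx t 0 x := by
    have := anc_idx t n 0 x
    rwa [zero_add] at this
  have h1 := H.le_sub_pend hr0 hr n (idx t n x)
  have hp0 := hpos 0
  have hpn := hpos n
  have h2 : μ.real (cell t 0 (idx t 0 x)) * (((2 : ℝ) ^ d)⁻¹ ^ n / 10) *
      (Real.exp (9 / 20 * ((2 : ℝ) ^ d)⁻¹ ^ L * H.cnt n (idx t n x)) *
        (1 / 20) ^ H.lnd n (idx t n x)) ≤
      ((n : ℝ) + 1) ^ 2 * μ.real (cell t n (idx t n x)) := by
    refine le_trans ?_ hn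
    rw [gainWeight, ha]
    gcongr
  have h3 := Real.log_le_log (by positivity) h2
  rw [Real.log_mul (by positivity) (by positivity), Real.log_mul (by positivity) (by positivity),
    Real.log_mul (by positivity) (by positivity), Real.log_mul (by positivity) (by positivity),
    Real.log_div (by positivity) (by norm_num), Real.log_exp, Real.log_pow, Real.log_pow,
    Real.log_pow, Real.log_inv, Real.log_pow, one_div, Real.log_inv] at h3
  push_cast at h3
  linarith

end MeanPorosity

/-! ### Porosity produces light holes around central points -/

namespace MeanPorosity

variable {d : ℕ}

lemma dist_le_sqrt_mul {x y : EuclideanSpace ℝ (Fin d)} {δ : ℝ} (hδ : 0 ≤ δ)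
    (h : ∀ c, |x c - y c| ≤ δ) : dist x y ≤ √d * δ := by
  rw [EuclideanSpace.dist_eq, ← Real.sqrt_sq hδ, ← Real.sqrt_mul (by positivity)]
  refine Real.sqrt_le_sqrt ?_
  calc ∑ c, dist (x c) (y c) ^ 2 ≤ ∑ _c : Fin d, δ ^ 2 := by
        refine Finset.sum_le_sum fun c _ => ?_
        rw [Real.dist_eq]
        exact pow_le_pow_left₀ (abs_nonneg _) (h c) 2
    _ = d * δ ^ 2 := by simp

lemma abs_coord_sub_le_dist (x y : EuclideanSpace ℝ (Fin d)) (c : Fin d) :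
    |x c - y c| ≤ dist x y := by
  rw [dist_eq_norm]
  exact PiLp.norm_apply_le (x - y) c

variable (t : Fin d → ℝ)

lemma cell_subset_closedBall (n : ℕ) (x : EuclideanSpace ℝ (Fin d)) :
    cell t n (idx t n x) ⊆ Metric.closedBall x (√d * (2 : ℝ)⁻¹ ^ n) := by
  intro y hy
  refine dist_le_sqrt_mul (by positivity) fun c => ?_
  have h1 : ⌊(2 : ℝ) ^ n * (y c + t c)⌋ = ⌊(2 : ℝ) ^ n * (x c + t c)⌋ := congrFun hy c
  have h2 := (Int.abs_sub_lt_one_of_floor_eq_floor h1).le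
  rw [← mul_sub, abs_mul, abs_of_pos (by positivity : (0 : ℝ) < 2 ^ n), add_sub_add_right_eq_sub]
    at h2
  rw [inv_pow, ← one_div, le_div_iff₀ (by positivity)]
  linarith

/-- The point `x` is in the middle half, in all coordinates, of its dyadic cell of level `n`. -/
def IsCentral (n : ℕ) (x : EuclideanSpace ℝ (Fin d)) : Prop :=
  ∀ c, 1 / 4 ≤ Int.fract ((2 : ℝ) ^ n * (x c + t c)) ∧ Int.fract ((2 : ℝ) ^ n * (x c + t c)) < 3 / 4

lemma IsCentral.closedBall_subset_cell {n : ℕ} {x : EuclideanSpace ℝ (Fin d)}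
    (h : IsCentral t n x) : Metric.closedBall x ((2 : ℝ)⁻¹ ^ (n + 2)) ⊆ cell t n (idx t n x) := by
  intro y hy
  funext c
  obtain ⟨h1, h2⟩ := h c
  have h3 := (abs_coord_sub_le_dist y x c).trans hy
  rw [inv_pow, ← one_div, le_div_iff₀ (by positivity), pow_add] at h3
  have h4 : |(2 : ℝ) ^ n * (y c + t c) - 2 ^ n * (x c + t c)| ≤ 1 / 4 := by
    rw [← mul_sub, abs_mul, abs_of_pos (by positivity : (0 : ℝ) < 2 ^ n),
      add_sub_add_right_eq_sub]
    linarith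
  rw [abs_le] at h4
  simp only [idx]
  have h5 := Int.floor_add_fract ((2 : ℝ) ^ n * (x c + t c))
  rw [Int.floor_eq_iff]
  constructor <;> linarith

/-- Porosity provides a ball of small relative mass. -/
lemma exists_closedBall_of_lt_por {μ : Measure (EuclideanSpace ℝ (Fin d))} [IsProbabilityMeasure μ]
    {x : EuclideanSpace ℝ (Fin d)} {r ε α : ℝ} (hr : 0 < r) (hε : 0 < ε) (hα : 0 ≤ α)
    (h : α < por μ x r ε) :
    ∃ y, Metric.closedBall y (α * r) ⊆ Metric.closedBall x r ∧
      μ.real (Metric.closedBall y (α * r)) ≤ 2 * ε * μ.real (Metric.closedBall x r) := by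
  rw [por] at h
  set S := {α : ℝ | 0 ≤ α ∧
    (⨅ (y : EuclideanSpace ℝ (Fin d))
        (_ : Metric.closedBall y (α * r) ⊆ Metric.closedBall x r),
      μ (Metric.closedBall y (α * r)) / μ (Metric.closedBall x r)) ≤ ENNReal.ofReal ε}
  -- The default `sSup ∅ = 0` is excluded by `0 ≤ α < por μ x r ε`.
  have hne : S.Nonempty := by
    by_contra hS
    rw [Set.not_nonempty_iff_eq_empty] at hS
    rw [hS, Real.sSup_empty] at h
    linarith
  obtain ⟨β, ⟨hβ0, hβ⟩, hαβ⟩ := exists_lt_of_lt_csSup hne h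
  -- The infimum over centres need not be attained; the factor `2` gives room to pick an actual
  -- ball.
  have h1 : ENNReal.ofReal ε < ENNReal.ofReal (2 * ε) :=
    (ENNReal.ofReal_lt_ofReal_iff (by linarith)).2 (by linarith)
  obtain ⟨y, hy⟩ := iInf_lt_iff.1 (hβ.trans_lt h1)
  obtain ⟨hsub, hy⟩ := iInf_lt_iff.1 hy
  have hsub' : Metric.closedBall y (α * r) ⊆ Metric.closedBall y (β * r) :=
    Metric.closedBall_subset_closedBall (mul_le_mul_of_nonneg_right hαβ.le hr.le)
  refine ⟨y, hsub'.trans hsub, ?_⟩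
  by_cases h0 : μ (Metric.closedBall x r) = 0
  · have : μ (Metric.closedBall y (α * r)) = 0 := measure_mono_null (hsub'.trans hsub) h0
    simp [measureReal_def, this, h0]
  · have h2 : μ (Metric.closedBall y (β * r)) ≤
        ENNReal.ofReal (2 * ε) * μ (Metric.closedBall x r) :=
      (ENNReal.div_le_iff_le_mul (Or.inl h0) (Or.inl (measure_ne_top _ _))).1 hy.le
    have h3 := ENNReal.toReal_mono (ENNReal.mul_ne_top ENNReal.ofReal_ne_top (measure_ne_top _ _))
      ((measure_mono hsub').trans h2)
    rwa [ENNReal.toReal_mul, ENNReal.toReal_ofReal (by positivity)] at h3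

variable (μ : Measure (EuclideanSpace ℝ (Fin d)))

open Classical in
/-- The system of all cells that contain a subcell `L` levels below of relative mass at most `ε`. -/
def lightHoles (L : ℕ) (ε : ℝ) : HoleSystem d L where
  cells n := {z | ∃ w, anc L w = z ∧ μ.real (cell t (n + L) w) ≤ ε * μ.real (cell t n z)}
  hole n z := if h : ∃ w, anc L w = z ∧ μ.real (cell t (n + L) w) ≤ ε * μ.real (cell t n z)
    then h.choose else z
  anc_hole n z hz := by
    have hz : ∃ w, anc L w = z ∧ μ.real (cell t (n + L) w) ≤ ε * μ.real (cell t n z) := hz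
    rw [dif_pos hz]
    exact hz.choose_spec.1

lemma measureReal_hole_lightHoles_le (L : ℕ) (ε : ℝ) (n : ℕ) (z : Fin d → ℤ)
    (hz : z ∈ (lightHoles t μ L ε).cells n) :
    μ.real (cell t (n + L) ((lightHoles t μ L ε).hole n z)) ≤ ε * μ.real (cell t n z) := by
  have hz' : ∃ w, anc L w = z ∧ μ.real (cell t (n + L) w) ≤ ε * μ.real (cell t n z) := hz
  have : (lightHoles t μ L ε).hole n z = hz'.choose := dif_pos hz'
  rw [this]
  exact hz'.choose_spec.2

/-- The ball of radius `2⁻¹ ^ (n + 2)` around a central point stays in its cell of level `n`. The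
nearly empty ball inside it has radius at least the diameter bound for cells of level `n + k + 2`,
so it contains the cell of that level around its centre. -/
lemma IsCentral.mem_cells_lightHoles [IsProbabilityMeasure μ] {n k : ℕ}
    {x : EuclideanSpace ℝ (Fin d)} (h : IsCentral t n x) {α ε : ℝ} (hε : 0 < ε)
    (hk : √d * (2 : ℝ)⁻¹ ^ k < α) (hpor : α ≤ por μ x ((2 : ℝ)⁻¹ ^ (n + 2)) ε) :
    idx t n x ∈ (lightHoles t μ (k + 2) (2 * ε)).cells n := by
  obtain ⟨y, hy1, hy2⟩ := exists_closedBall_of_lt_por (by positivity) hε (by positivity)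
    (hk.trans_le hpor)
  have hb := h.closedBall_subset_cell
  have hyx : idx t n y = idx t n x :=
    hb (hy1 (Metric.mem_closedBall_self (by positivity)))
  refine ⟨idx t (n + (k + 2)) y, by rw [anc_idx, hyx], ?_⟩
  have h1 : cell t (n + (k + 2)) (idx t (n + (k + 2)) y) ⊆
      Metric.closedBall y (√d * (2 : ℝ)⁻¹ ^ k * (2 : ℝ)⁻¹ ^ (n + 2)) := by
    have := cell_subset_closedBall t (n + (k + 2)) y
    rwa [show n + (k + 2) = k + (n + 2) by ring, pow_add, ← mul_assoc,
      show k + (n + 2) = n + (k + 2) by ring] at this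
  calc _ ≤ _ := measureReal_mono h1
    _ ≤ _ := hy2
    _ ≤ _ := mul_le_mul_of_nonneg_left (measureReal_mono hb) (by positivity)

/-! ### Translates of the dyadic lattice -/

/-- Among the `2 h + 1` equally spaced translates of a point of the circle by multiples of
`2 ^ n / (2 h + 1)`, at least `h` are in a given half circle. -/
lemma le_card_fract_translate (h n : ℕ) (u : ℝ) :
    h ≤ (Finset.univ.filter fun j : ZMod (2 * h + 1) =>
      1 / 4 ≤ Int.fract ((2 : ℝ) ^ n * (u + (j.val : ℝ) / (2 * h + 1))) ∧
        Int.fract ((2 : ℝ) ^ n * (u + (j.val : ℝ) / (2 * h + 1))) < 3 / 4).card := by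
  set m := 2 * h + 1 with hm
  set W : ℝ := m * (2 ^ n * u) with hW
  set A := ⌊W⌋ with hA
  set f := Int.fract W with hf
  have hf0 : 0 ≤ f := Int.fract_nonneg _
  have hf1 : f < 1 := Int.fract_lt_one _
  have hWA : (A : ℝ) + f = W := Int.floor_add_fract W
  have hmpos : (0 : ℝ) < m := by positivity
  have hm' : (m : ℝ) = 2 * h + 1 := by rw [hm]; push_cast; ring
  -- On the circle the translates are the points `(j + f) / m`; `a` is the first `j` with `(j + f) /
  -- m ≥ 1/4`, and `a, …, a + h - 1` remain below `3/4`.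
  set a : ℕ := ⌈(m : ℝ) / 4 - f⌉₊ with ha
  have ha1 : (m : ℝ) / 4 - f ≤ a := Nat.le_ceil _
  have ha2 : (a : ℝ) < (m : ℝ) / 4 - f + 1 := by
    rcases le_or_gt 0 ((m : ℝ) / 4 - f) with h0 | h0
    · exact Nat.ceil_lt_add_one h0
    · have : a = 0 := Nat.ceil_eq_zero.2 h0.le
      rw [this]; push_cast; linarith
  have hunit : IsUnit ((2 : ZMod m) ^ n) := by
    have h2 : IsUnit ((2 : ℕ) : ZMod m) := by
      rw [ZMod.isUnit_iff_coprime, hm]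
      simp
    have := h2.pow n
    simpa using this
  -- The translate sent to position `a + k`: the solution of `A + 2 ^ n * j = a + k` modulo the odd
  -- number `m`.
  set g : ℕ → ZMod m := fun k => (((a + k : ℕ) : ZMod m) - (A : ZMod m)) * ((2 : ZMod m) ^ n)⁻¹
    with hg
  have hgk : ∀ k, (A : ZMod m) + 2 ^ n * g k = ((a + k : ℕ) : ZMod m) := by
    intro k
    rw [hg]
    simp only
    rw [mul_comm _ ((2 : ZMod m) ^ n)⁻¹, ← mul_assoc, ZMod.mul_inv_of_unit _ hunit]
    ring
  have hlt : ∀ k < h, (((a + k : ℕ) : ℝ)) + f < 3 / 4 * m := by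
    intro k hk
    have : (k : ℝ) + 1 ≤ h := by exact_mod_cast hk
    push_cast
    linarith
  have hcard : (Finset.range h).card ≤ (Finset.univ.filter fun j : ZMod m =>
      1 / 4 ≤ Int.fract ((2 : ℝ) ^ n * (u + (j.val : ℝ) / (2 * h + 1))) ∧
        Int.fract ((2 : ℝ) ^ n * (u + (j.val : ℝ) / (2 * h + 1))) < 3 / 4).card := by
    refine Finset.card_le_card_of_injOn g ?_ ?_
    · intro k hk
      have hk : k < h := by simpa using hk
      have h1 : (((A + 2 ^ n * (g k).val : ℤ)) : ZMod m) = (((a + k : ℕ) : ℤ) : ZMod m) := by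
        have := hgk k
        push_cast at this ⊢
        rw [ZMod.natCast_zmod_val]
        exact this
      rw [ZMod.intCast_eq_intCast_iff_dvd_sub] at h1
      obtain ⟨q, hq⟩ := h1
      have hq' : (((a + k : ℕ) : ℝ)) - (A + 2 ^ n * (g k).val) = m * q := by exact_mod_cast hq
      have hval : (2 : ℝ) ^ n * (u + ((g k).val : ℝ) / (2 * h + 1)) =
          (((a + k : ℕ) : ℝ) + f) / m - q := by
        rw [← hm']
        field_simp
        have : (m : ℝ) * (2 ^ n * u) = A + f := by rw [hWA]
        linarith
      have h3 := hlt k hk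
      have hfr : Int.fract ((2 : ℝ) ^ n * (u + ((g k).val : ℝ) / (2 * h + 1))) =
          (((a + k : ℕ) : ℝ) + f) / m := by
        rw [hval, Int.fract_sub_intCast, Int.fract_eq_self]
        refine ⟨by positivity, ?_⟩
        rw [div_lt_one hmpos]
        linarith
      simp only [Finset.coe_filter, Finset.mem_univ, true_and, Set.mem_ofPred_eq]
      rw [hfr, le_div_iff₀ hmpos, div_lt_iff₀ hmpos]
      refine ⟨?_, h3⟩
      push_cast
      have : (0 : ℝ) ≤ k := by positivity
      linarith
    · intro k hk k' hk' hkk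
      have hk : k < h := by simpa using hk
      have hk' : k' < h := by simpa using hk'
      have h1 : ((a + k : ℕ) : ZMod m) = ((a + k' : ℕ) : ZMod m) := by
        rw [← hgk k, ← hgk k', hkk]
      have hb : ∀ k < h, a + k < m := by
        intro k hk
        have h3 := hlt k hk
        have : ((a + k : ℕ) : ℝ) < m := by linarith
        exact_mod_cast this
      rw [ZMod.natCast_eq_natCast_iff', Nat.mod_eq_of_lt (hb k hk),
        Nat.mod_eq_of_lt (hb k' hk')] at h1
      omega
  simpa using hcard

/-- The translation by a tuple of multiples of `1 / (2 h + 1)`. -/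
def shift {h : ℕ} (s : Fin d → ZMod (2 * h + 1)) : Fin d → ℝ :=
  fun c => ((s c).val : ℝ) / (2 * h + 1)

open Classical in
lemma le_card_isCentral_shift (h n : ℕ) (x : EuclideanSpace ℝ (Fin d)) :
    h ^ d ≤ (Finset.univ.filter fun s : Fin d → ZMod (2 * h + 1) =>
      IsCentral (shift s) n x).card := by
  have h1 : (Finset.univ.filter fun s : Fin d → ZMod (2 * h + 1) => IsCentral (shift s) n x) =
      Fintype.piFinset fun c => Finset.univ.filter fun j : ZMod (2 * h + 1) =>
      1 / 4 ≤ Int.fract ((2 : ℝ) ^ n * (x c + (j.val : ℝ) / (2 * h + 1))) ∧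
        Int.fract ((2 : ℝ) ^ n * (x c + (j.val : ℝ) / (2 * h + 1))) < 3 / 4 := by
    ext s
    simp [IsCentral, shift]
  rw [h1, Fintype.card_piFinset]
  calc h ^ d = ∏ _c : Fin d, h := by simp
    _ ≤ _ := Finset.prod_le_prod' fun c _ => le_card_fract_translate h n (x c)

open Classical in
/-- For every set `I` of levels, some translate of the dyadic lattice has `x` in the central part
of its cell for a definite proportion of the levels in `I`. -/
lemma exists_shift_card_isCentral (h : ℕ) (x : EuclideanSpace ℝ (Fin d)) (I : Finset ℕ) :
    ∃ s : Fin d → ZMod (2 * h + 1), h ^ d * I.card ≤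
      (2 * h + 1) ^ d * (I.filter fun n => IsCentral (shift s) n x).card := by
  by_contra hcon
  push Not at hcon
  -- Double counting of the pairs (translate, level) for which `x` is central.
  have h1 : ∑ s : Fin d → ZMod (2 * h + 1), (I.filter fun n => IsCentral (shift s) n x).card =
      ∑ n ∈ I, (Finset.univ.filter fun s : Fin d → ZMod (2 * h + 1) =>
        IsCentral (shift s) n x).card := by
    simp_rw [Finset.card_filter]
    exact Finset.sum_comm
  have h2 : h ^ d * I.card ≤ ∑ n ∈ I, (Finset.univ.filter fun s : Fin d → ZMod (2 * h + 1) =>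
        IsCentral (shift s) n x).card := by
    have := Finset.sum_le_sum fun n (_ : n ∈ I) => le_card_isCentral_shift h n x
    rw [Finset.sum_const, smul_eq_mul] at this
    linarith
  have h3 := Finset.sum_lt_sum_of_nonempty (Finset.univ_nonempty)
    (fun s (_ : s ∈ Finset.univ) => hcon s)
  rw [← Finset.mul_sum, Finset.sum_const, Finset.card_univ, Fintype.card_fun, ZMod.card,
    Fintype.card_fin, smul_eq_mul, h1] at h3
  have h4 := Nat.lt_of_mul_lt_mul_left h3
  omega

end MeanPorosity

/-! ### The upper bound for the packing dimension -/

namespace MeanPorosity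

variable {d : ℕ}

/-- Absorbs the logarithmic and constant errors into an arbitrarily small linear term; with `K = 0`
it absorbs constants. -/
lemma eventually_log_add_le (K C : ℝ) {δ : ℝ} (hδ : 0 < δ) :
    ∀ᶠ n : ℕ in atTop, K * Real.log ((n : ℝ) + 1) + C ≤ δ * n := by
  have hn : Tendsto (fun n : ℕ => (n : ℝ) + 1) atTop atTop :=
    tendsto_atTop_add_const_right _ _ tendsto_natCast_atTop_atTop
  have h1 := (Real.isLittleO_log_id_atTop.comp_tendsto hn).bound
    (show 0 < δ / (2 * (|K| + 1)) by positivity)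
  have h2 : ∀ᶠ n : ℕ in atTop, 2 * (δ + C) / δ ≤ n :=
    tendsto_natCast_atTop_atTop.eventually (eventually_ge_atTop _)
  filter_upwards [h1, h2] with n h1 h2
  simp only [Function.comp, id, Real.norm_eq_abs] at h1
  rw [abs_of_pos (show (0 : ℝ) < n + 1 by positivity)] at h1
  rw [div_le_iff₀ hδ] at h2
  have h3 : K * Real.log ((n : ℝ) + 1) ≤ δ / 2 * (n + 1) := by
    calc K * Real.log ((n : ℝ) + 1) ≤ |K| * |Real.log ((n : ℝ) + 1)| := by
          rw [← abs_mul]; exact le_abs_self _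
      _ ≤ (|K| + 1) * (δ / (2 * (|K| + 1)) * (n + 1)) := by
          gcongr
          linarith
      _ = _ := by field_simp
  linarith

open Classical in
lemma HoleSystem.card_le_cnt {L : ℕ} (H : HoleSystem d L) (t : Fin d → ℝ) (I : Finset ℕ) (N : ℕ)
    (hI : ∀ n ∈ I, n < N) (x : EuclideanSpace ℝ (Fin d)) (h : ∀ n ∈ I, idx t n x ∈ H.cells n) :
    I.card ≤ H.cnt N (idx t N x) := by
  refine Finset.card_le_card fun n hn => ?_
  have hnN := hI n hn
  simp only [Finset.mem_filter, Finset.mem_range]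
  refine ⟨hnN, ?_⟩
  have := anc_idx t (N - n) n x
  rw [show n + (N - n) = N by omega] at this
  rw [this]
  exact h n hn

/-- The origin of the constant: `9/20 * 8/9 = 2/5`, and `8 ^ d * 2 ^ d = 2 ^ (4 * d)`. The choice `h
= 9 * d` makes Bernoulli's inequality give `(h / (2 * h + 1)) ^ d ≥ 8/9 * 2 ^ (-d)`, and `8 √d` is
`2 √d` from the rounding of `α` times `4` from the two extra levels. -/
lemma porosityConst_mul_le (hd : 1 ≤ d) {α : ℝ} (hα : 0 < α) {k : ℕ}
    (hk : α ≤ 2 * (√d * (2 : ℝ)⁻¹ ^ k)) :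
    porosityConst d * α ^ d * Real.log 2 ≤
      9 / 20 * ((2 ^ d)⁻¹) ^ (k + 2) * (((9 * d : ℕ) : ℝ) / (2 * (9 * d : ℕ) + 1)) ^ d := by
  have hd' : (1 : ℝ) ≤ d := by exact_mod_cast hd
  have hlog : 0 < Real.log 2 := Real.log_pos (by norm_num)
  have hsd : (d : ℝ) ^ ((d : ℝ) / 2) = √d ^ d := by
    rw [Real.sqrt_eq_rpow, ← Real.rpow_natCast, ← Real.rpow_mul (by positivity)]
    congr 1; ring
  have hs : 0 < √(d : ℝ) := Real.sqrt_pos.2 (by linarith)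
  have h1 : 8 / 9 * (1 / 2 : ℝ) ^ d ≤ (((9 * d : ℕ) : ℝ) / (2 * (9 * d : ℕ) + 1)) ^ d := by
    have e : (((9 * d : ℕ) : ℝ) / (2 * (9 * d : ℕ) + 1)) = (1 / 2) * (1 + -(1 / (18 * d + 1))) := by
      push_cast; field_simp; ring
    rw [e, mul_pow, mul_comm]
    refine mul_le_mul_of_nonneg_left ?_ (by positivity)
    have h2 : (1 : ℝ) / (18 * d + 1) ≤ 1 := by rw [div_le_one (by positivity)]; linarith
    have h3 := one_add_mul_le_pow (show (-2 : ℝ) ≤ -(1 / (18 * d + 1)) by linarith) d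
    refine le_trans ?_ h3
    have : (d : ℝ) * (1 / (18 * d + 1)) ≤ 1 / 9 := by
      rw [mul_one_div, div_le_div_iff₀ (by positivity) (by norm_num)]; linarith
    linarith
  have h2 : (α / (8 * √d)) ^ d ≤ ((2 ^ d : ℝ)⁻¹) ^ (k + 2) := by
    rw [← inv_pow, ← pow_mul, mul_comm d, pow_mul]
    refine pow_le_pow_left₀ (by positivity) ?_ d
    rw [div_le_iff₀ (by positivity), pow_add]
    linarith
  calc porosityConst d * α ^ d * Real.log 2
      = 9 / 20 * (α / (8 * √d)) ^ d * (8 / 9 * (1 / 2 : ℝ) ^ d) := by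
        rw [porosityConst, hsd, div_pow, mul_pow, show (2 : ℝ) ^ (4 * d) = 8 ^ d * 2 ^ d by
          rw [← mul_pow, pow_mul]; norm_num, div_pow, one_pow]
        field_simp
        norm_num
    _ ≤ _ := by gcongr

open Classical in
lemma card_filter_range_le_card_filter_range_shift (p : ℕ → Prop) (N : ℕ) :
    ((Finset.range N).filter p).card ≤ ((Finset.range N).filter fun n => p (n + 2)).card + 2 := by
  have h : (Finset.range N).filter p ⊆
      ((Finset.range N).filter fun n => p (n + 2)).image (· + 2) ∪ {0, 1} := by
    intro n hn
    simp only [Finset.mem_filter, Finset.mem_range] at hn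
    simp only [Finset.mem_union, Finset.mem_image, Finset.mem_filter, Finset.mem_range,
      Finset.mem_insert, Finset.mem_singleton]
    rcases n with _ | _ | n
    · simp
    · simp
    · exact Or.inl ⟨n, ⟨by omega, hn.2⟩, rfl⟩
  calc _ ≤ _ := Finset.card_le_card h
    _ ≤ _ := Finset.card_union_le _ _
    _ ≤ _ := Nat.add_le_add Finset.card_image_le Finset.card_le_two

/-- At a typical point and large `N`, a translate with many central porous levels meets at least
about `ρ * η * N` holes, each worth `a`, while landings contribute at most a small multiple of `N`.
-/
lemma IsMeanPorous.ae_eventually_le_log (hd : 1 ≤ d) (μ : Measure (EuclideanSpace ℝ (Fin d)))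
    [IsProbabilityMeasure μ] {α η : ℝ} (hα : 0 < α) (hα1 : α ≤ 1 / 2) (hη : 0 < η)
    (hpor : IsMeanPorous μ α η) {δ : ℝ} (hδ : 0 < δ) :
    ∀ᵐ x ∂μ, ∀ᶠ N : ℕ in atTop,
      -(((d - porosityConst d * η * α ^ d) * Real.log 2 + δ) * N) ≤
        Real.log (μ.real (Metric.closedBall x (√d * (2 : ℝ)⁻¹ ^ N))) := by
  classical
  have hd' : (1 : ℝ) ≤ d := by exact_mod_cast hd
  have hs : 1 ≤ √(d : ℝ) := Real.one_le_sqrt.2 hd'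
  -- `k = k' + 1` is the least depth with `√d * 2⁻¹ ^ k < α`.
  obtain ⟨k', hk1, hk2⟩ := exists_nat_pow_near_of_lt_one (x := α / √d) (y := (2 : ℝ)⁻¹)
    (by positivity) (by rw [div_le_one (by positivity)]; linarith) (by norm_num) (by norm_num)
  obtain ⟨k, hkk⟩ : ∃ k, k = k' + 1 := ⟨_, rfl⟩
  rw [← hkk, lt_div_iff₀ (by positivity)] at hk1
  have hka : α ≤ 2 * (√d * (2 : ℝ)⁻¹ ^ k) := by
    rw [div_le_iff₀ (by positivity)] at hk2
    rw [hkk, pow_succ]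
    linarith
  have hkb : √d * (2 : ℝ)⁻¹ ^ k < α := by linarith
  set L := k + 2 with hL
  set h := 9 * d with hh
  set ρ : ℝ := ((h : ℝ) / (2 * h + 1)) ^ d with hρ
  set a : ℝ := 9 / 20 * ((2 ^ d : ℝ)⁻¹) ^ L with ha
  set G : ℝ := a * ρ with hG
  have hGle : porosityConst d * α ^ d * Real.log 2 ≤ G := porosityConst_mul_le hd hα hka
  have ha0 : 0 ≤ a := by positivity
  have hρ0 : 0 ≤ ρ := by positivity
  have hG0 : 0 ≤ G := by positivity
  set b : ℝ := Real.log (1 + 1 / (2 * L)) with hb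
  have hL0 : (0 : ℝ) < L := by rw [hL]; positivity
  have hb0 : 0 < b := Real.log_pos (by
    have : 0 < 1 / (2 * (L : ℝ)) := by positivity
    linarith)
  set K : ℝ := Real.log 20 / b with hK
  have hK0 : 0 < K := div_pos (Real.log_pos (by norm_num)) hb0
  -- Chosen after `L`: the holes have relative mass at most `2 * ε ≤ 1/4`, and the landings cost at
  -- most `8 * ε * K * N ≤ δ / 2 * N` up to logarithms.
  set ε : ℝ := min (1 / 8) (δ / (16 * K)) with hε
  have hε0 : 0 < ε := by positivity
  have hε1 : ε ≤ 1 / 8 := min_le_left _ _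
  have hε2 : 8 * ε * K ≤ δ / 2 := by
    have : ε ≤ δ / (16 * K) := min_le_right _ _
    rw [le_div_iff₀ (by positivity)] at this
    linarith
  set δ' : ℝ := δ / (4 * (G + 1)) with hδ'
  have hδ0 : 0 < δ' := by positivity
  have hδG : G * δ' ≤ δ / 4 := by
    rw [hδ', mul_div_assoc', div_le_div_iff₀ (by positivity) (by norm_num)]
    nlinarith
  -- The good translate depends on `x` and `N`, so the almost sure bounds are taken for all of the
  -- finitely many translates at once.
  have hA := ae_all_iff.2 fun s : Fin d → ZMod (2 * h + 1) =>
    (lightHoles (shift s) μ L (2 * ε)).ae_eventually_lnd_le (shift s) μ (by omega)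
      (by positivity) (by linarith) (measureReal_hole_lightHoles_le (shift s) μ L (2 * ε))
  have hB := ae_all_iff.2 fun s : Fin d → ZMod (2 * h + 1) =>
    (lightHoles (shift s) μ L (2 * ε)).ae_eventually_le_log_measureReal_cell (shift s) μ
      (by omega) hd
  have hP := ae_all_iff.2 fun s : Fin d → ZMod (2 * h + 1) => ae_measureReal_cell_pos (shift s) μ
  filter_upwards [hA, hB, hP, hpor ε hε0] with x hA hB hP hx
  choose C hB using hB
  have hev : ∀ᶠ N : ℕ in atTop, η - δ' < porousProportion μ α ε x N := by
    refine eventually_lt_of_lt_liminf (by linarith) ?_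
    exact isBoundedUnder_of ⟨0, fun N => by unfold porousProportion; positivity⟩
  have hC : ∀ᶠ N : ℕ in atTop, ∀ s : Fin d → ZMod (2 * h + 1),
      (2 * K + 2) * Real.log ((N : ℝ) + 1) + (C s + 2 * G) ≤ δ / 4 * N :=
    eventually_all.2 fun s => eventually_log_add_le _ _ (by positivity)
  filter_upwards [eventually_all.2 hA, eventually_all.2 hB, hev, hC, eventually_gt_atTop 0] with
    N hA hB hN hC hN0
  have hN0' : (0 : ℝ) < N := by exact_mod_cast hN0
  set p : ℕ → Prop := fun i => α ≤ por μ x ((2 : ℝ)⁻¹ ^ i) ε with hp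
  -- Level `n` is paired with the ball of radius `2⁻¹ ^ (n + 2)`; the shift loses at most two porous
  -- scales.
  set I := (Finset.range N).filter fun n => p (n + 2) with hI
  obtain ⟨s, hs⟩ := exists_shift_card_isCentral h x I
  have hcnt := (lightHoles (shift s) μ L (2 * ε)).card_le_cnt (shift s)
    (I.filter fun n => IsCentral (shift s) n x) N
    (fun n hn => by
      have := (Finset.mem_filter.1 hn).1
      rw [hI, Finset.mem_filter] at this
      exact Finset.mem_range.1 this.1) x
    (fun n hn => by
      obtain ⟨h1, h2⟩ := Finset.mem_filter.1 hn
      rw [hI, Finset.mem_filter] at h1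
      exact h2.mem_cells_lightHoles (shift s) μ hε0 hkb h1.2)
  have hcardI : (η - δ') * N ≤ I.card + 2 := by
    have h1 := card_filter_range_le_card_filter_range_shift p N
    have h2 : (((Finset.range N).filter p).card : ℝ) ≤ I.card + 2 := by exact_mod_cast h1
    refine le_trans ?_ h2
    rw [porousProportion, lt_div_iff₀ hN0'] at hN
    exact hN.le
  set c : ℝ := ((lightHoles (shift s) μ L (2 * ε)).cnt N (idx (shift s) N x) : ℝ) with hc
  set l : ℝ := ((lightHoles (shift s) μ L (2 * ε)).lnd N (idx (shift s) N x) : ℝ) with hl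
  have h1 : ρ * I.card ≤ c := by
    have h2 : ((I.filter fun n => IsCentral (shift s) n x).card : ℝ) ≤ c := by
      rw [hc]; exact_mod_cast hcnt
    refine le_trans ?_ h2
    rw [hρ, div_pow, div_mul_eq_mul_div, div_le_iff₀ (by positivity), mul_comm _ ((2 * (h : ℝ) + 1) ^ d)]
    exact_mod_cast hs
  have hBs := hB s
  have hAs := hA s
  rw [← ha, ← hc, ← hl] at hBs
  rw [← hb, ← hl] at hAs
  have h2 : Real.log 20 * l ≤ K * (4 * (2 * ε) * N + 2 * Real.log (N + 1)) := by
    rw [hK, div_mul_eq_mul_div, le_div_iff₀ hb0, mul_assoc]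
    exact mul_le_mul_of_nonneg_left hAs (Real.log_nonneg (by norm_num))
  have h3 : G * ((η - δ') * N - 2) ≤ a * c := by
    calc G * ((η - δ') * N - 2) ≤ G * I.card := mul_le_mul_of_nonneg_left (by linarith) hG0
      _ = a * (ρ * I.card) := by rw [hG]; ring
      _ ≤ _ := mul_le_mul_of_nonneg_left h1 ha0
  have h4 : Real.log (μ.real (cell (shift s) N (idx (shift s) N x))) ≤
      Real.log (μ.real (Metric.closedBall x (√d * (2 : ℝ)⁻¹ ^ N))) :=
    Real.log_le_log (hP s N) (measureReal_mono (cell_subset_closedBall (shift s) N x))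
  have h5 := hC s
  have h6 : 8 * ε * K * N ≤ δ / 2 * N := mul_le_mul_of_nonneg_right hε2 hN0'.le
  have h7 : G * δ' * N ≤ δ / 4 * N := mul_le_mul_of_nonneg_right hδG hN0'.le
  have h8 : porosityConst d * α ^ d * Real.log 2 * (η * N) ≤ G * (η * N) :=
    mul_le_mul_of_nonneg_right hGle (by positivity)
  nlinarith

/-- An upper bound for the upper local dimension from a lower bound for the masses of the balls
of radii `√d * 2⁻ᴺ`. -/
lemma upperLocalDim_le (hd : 1 ≤ d) (μ : Measure (EuclideanSpace ℝ (Fin d)))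
    [IsProbabilityMeasure μ] {x : EuclideanSpace ℝ (Fin d)} {s s' : ℝ} (hss : s < s')
    (hpos : ∀ r > 0, 0 < μ.real (Metric.closedBall x r))
    (h : ∀ᶠ N : ℕ in atTop, -(s * Real.log 2 * N) ≤
        Real.log (μ.real (Metric.closedBall x (√d * (2 : ℝ)⁻¹ ^ N)))) :
    upperLocalDim μ x ≤ s' := by
  have hlog : 0 < Real.log 2 := Real.log_pos (by norm_num)
  have hd' : (1 : ℝ) ≤ d := by exact_mod_cast hd
  have hs : 1 ≤ √(d : ℝ) := Real.one_le_sqrt.2 hd'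
  have hE : ∀ᶠ N : ℕ in atTop, 0 * Real.log ((N : ℝ) + 1) +
      (|s'| * (Real.log 2 + Real.log √d)) ≤ ((s' - s) * Real.log 2) * N :=
    eventually_log_add_le _ _ (mul_pos (by linarith) hlog)
  obtain ⟨N₀, hN₀⟩ := eventually_atTop.1 (h.and hE)
  refine limsup_le_of_le ?_ ?_
  · isBoundedDefault
  have hr : ∀ᶠ r : ℝ in 𝓝[>] 0, r ∈ Set.Ioo 0 (min 1 ((2 : ℝ)⁻¹ ^ N₀)) :=
    Ioo_mem_nhdsGT (by positivity)
  filter_upwards [hr] with r ⟨hr0, hr1⟩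
  have hr2 : r < 1 := hr1.trans_le (min_le_left _ _)
  have hr3 : r < (2 : ℝ)⁻¹ ^ N₀ := hr1.trans_le (min_le_right _ _)
  -- Rounds `r` down to a radius `√d * 2⁻¹ ^ (k + 1)`, which changes `log r` by at most `log 2`.
  obtain ⟨k, hk1, hk2⟩ := exists_nat_pow_near_of_lt_one (x := r / √d) (y := (2 : ℝ)⁻¹)
    (by positivity) (by rw [div_le_one (by positivity)]; linarith) (by norm_num) (by norm_num)
  rw [lt_div_iff₀ (by positivity)] at hk1
  rw [div_le_iff₀ (by positivity)] at hk2
  have hkN : N₀ ≤ k + 1 := by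
    by_contra hcon
    have h1 : (2 : ℝ)⁻¹ ^ N₀ ≤ (2 : ℝ)⁻¹ ^ (k + 1) :=
      pow_le_pow_of_le_one (by norm_num) (by norm_num) (by omega)
    have h2 : (2 : ℝ)⁻¹ ^ (k + 1) ≤ (2 : ℝ)⁻¹ ^ (k + 1) * √d :=
      le_mul_of_one_le_right (by positivity) hs
    linarith
  obtain ⟨hN1, hN2⟩ := hN₀ (k + 1) hkN
  set N := k + 1 with hN
  have hmass : Real.log (μ.real (Metric.closedBall x (√d * (2 : ℝ)⁻¹ ^ N))) ≤
      Real.log (μ.real (Metric.closedBall x r)) := by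
    refine Real.log_le_log (hpos _ (by positivity)) (measureReal_mono ?_)
    exact Metric.closedBall_subset_closedBall (by linarith)
  have hlr : Real.log r < 0 := Real.log_neg hr0 hr2
  have hlr1 : -(N * Real.log 2) + Real.log √d ≤ Real.log r := by
    have := Real.log_le_log (by positivity) hk1.le
    rw [Real.log_mul (by positivity) (by positivity), Real.log_pow, Real.log_inv] at this
    linarith
  have hlr2 : Real.log r ≤ -((N - 1) * Real.log 2) + Real.log √d := by
    have := Real.log_le_log (by positivity) hk2
    rw [Real.log_mul (by positivity) (by positivity), Real.log_pow, Real.log_inv] at this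
    rw [hN]; push_cast; linarith
  have hls : 0 ≤ Real.log √d := Real.log_nonneg hs
  have hfin : s' * Real.log r ≤ Real.log (μ.real (Metric.closedBall x r)) := by
    have h1 : s' * Real.log r ≤ -(s' * (N * Real.log 2)) + |s'| * (Real.log 2 + Real.log √d) := by
      have h2 : s' * (Real.log r + N * Real.log 2) ≤ |s'| * (Real.log 2 + Real.log √d) := by
        calc s' * (Real.log r + N * Real.log 2) ≤ |s'| * (Real.log r + N * Real.log 2) :=
              mul_le_mul_of_nonneg_right (le_abs_self _) (by linarith)
          _ ≤ _ := mul_le_mul_of_nonneg_left (by linarith) (abs_nonneg _)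
      linarith
    linarith
  rw [logRatio, ← ofReal_measureReal, ENNReal.log_ofReal_of_pos (hpos r hr0), ← EReal.coe_div,
    EReal.coe_le_coe_iff, div_le_iff_of_neg hlr]
  exact hfin

lemma ae_measureReal_closedBall_pos (μ : Measure (EuclideanSpace ℝ (Fin d)))
    [IsProbabilityMeasure μ] : ∀ᵐ x ∂μ, ∀ r > 0, 0 < μ.real (Metric.closedBall x r) := by
  filter_upwards [Measure.support_mem_ae (μ := μ)] with x hx r hr
  have h1 : 0 < μ (Metric.closedBall x r) :=
    (Measure.mem_support_iff_forall _).1 hx _ (Metric.closedBall_mem_nhds x hr)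
  exact ENNReal.toReal_pos h1.ne' (measure_ne_top _ _)

/-- The packing dimension of a mean porous measure is bounded away from `d`. -/
lemma packingDim_le_of_isMeanPorous (hd : 1 ≤ d) (μ : Measure (EuclideanSpace ℝ (Fin d)))
    [IsProbabilityMeasure μ] {α η : ℝ} (hα : 0 < α) (hα1 : α ≤ 1 / 2) (hη : 0 < η)
    (hpor : IsMeanPorous μ α η) :
    packingDim μ ≤ ((d - porosityConst d * η * α ^ d : ℝ) : EReal) := by
  have hlog : 0 < Real.log 2 := Real.log_pos (by norm_num)
  refine EReal.le_of_forall_lt_iff_le.1 fun s' hs' => ?_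
  rw [EReal.coe_lt_coe_iff] at hs'
  set s := (d - porosityConst d * η * α ^ d : ℝ) with hs
  refine essSup_le_of_ae_le _ ?_
  have hδ : 0 < (s' - s) / 2 * Real.log 2 := mul_pos (by linarith) hlog
  filter_upwards [hpor.ae_eventually_le_log hd μ hα hα1 hη hδ, ae_measureReal_closedBall_pos μ]
    with x hx hpos
  refine upperLocalDim_le hd μ (show (s + s') / 2 < s' by linarith) hpos ?_
  filter_upwards [hx] with N hN
  refine le_trans (le_of_eq ?_) hN
  ring

end MeanPorosity

/-! ### Measures with independent digits -/

namespace MeanPorosity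

variable {d : ℕ}

/-- A lower bound for the lower local dimension from an upper bound for the masses of the balls
of radii `2⁻ᴺ`. -/
lemma le_lowerLocalDim (μ : Measure (EuclideanSpace ℝ (Fin d)))
    [IsProbabilityMeasure μ] {x : EuclideanSpace ℝ (Fin d)} {s s' : ℝ} (hss : s' < s)
    (hpos : ∀ r > 0, 0 < μ.real (Metric.closedBall x r))
    (h : ∀ᶠ N : ℕ in atTop, Real.log (μ.real (Metric.closedBall x ((2 : ℝ)⁻¹ ^ N))) ≤
      -(s * Real.log 2 * N)) :
    s' ≤ lowerLocalDim μ x := by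
  have hlog : 0 < Real.log 2 := Real.log_pos (by norm_num)
  have hE : ∀ᶠ N : ℕ in atTop, 0 * Real.log ((N : ℝ) + 1) +
      (|s'| * Real.log 2) ≤ ((s - s') * Real.log 2) * N :=
    eventually_log_add_le _ _ (mul_pos (by linarith) hlog)
  obtain ⟨N₀, hN₀⟩ := eventually_atTop.1 (h.and hE)
  refine le_liminf_of_le ?_ ?_
  · isBoundedDefault
  have hr : ∀ᶠ r : ℝ in 𝓝[>] 0, r ∈ Set.Ioo 0 (min 1 ((2 : ℝ)⁻¹ ^ (N₀ + 1))) :=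
    Ioo_mem_nhdsGT (by positivity)
  filter_upwards [hr] with r ⟨hr0, hr1⟩
  have hr2 : r < 1 := hr1.trans_le (min_le_left _ _)
  have hr3 : r < (2 : ℝ)⁻¹ ^ (N₀ + 1) := hr1.trans_le (min_le_right _ _)
  obtain ⟨N, hk1, hk2⟩ := exists_nat_pow_near_of_lt_one (y := (2 : ℝ)⁻¹)
    hr0 hr2.le (by norm_num) (by norm_num)
  have hkN : N₀ ≤ N := by
    by_contra hcon
    have h1 : (2 : ℝ)⁻¹ ^ (N₀ + 1) ≤ (2 : ℝ)⁻¹ ^ (N + 1) :=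
      pow_le_pow_of_le_one (by norm_num) (by norm_num) (by omega)
    linarith
  obtain ⟨hN1, hN2⟩ := hN₀ N hkN
  have hmass : Real.log (μ.real (Metric.closedBall x r)) ≤
      Real.log (μ.real (Metric.closedBall x ((2 : ℝ)⁻¹ ^ N))) :=
    Real.log_le_log (hpos _ hr0) (measureReal_mono (Metric.closedBall_subset_closedBall hk2))
  have hlr : Real.log r < 0 := Real.log_neg hr0 hr2
  have hlr1 : -((N + 1) * Real.log 2) ≤ Real.log r := by
    have := Real.log_le_log (by positivity) hk1.le
    rw [Real.log_pow, Real.log_inv] at this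
    push_cast at this
    linarith
  have hlr2 : Real.log r ≤ -(N * Real.log 2) := by
    have := Real.log_le_log (by positivity) hk2
    rw [Real.log_pow, Real.log_inv] at this
    linarith
  have hfin : Real.log (μ.real (Metric.closedBall x r)) ≤ s' * Real.log r := by
    have h2 : -s' * (Real.log r + N * Real.log 2) ≤ |s'| * Real.log 2 := by
      have h3 : |Real.log r + N * Real.log 2| ≤ Real.log 2 := by
        rw [abs_le]; constructor <;> linarith
      calc -s' * (Real.log r + N * Real.log 2) ≤ |-s' * (Real.log r + N * Real.log 2)| :=
            le_abs_self _
        _ = |s'| * |Real.log r + N * Real.log 2| := by rw [abs_mul, abs_neg]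
        _ ≤ _ := mul_le_mul_of_nonneg_left h3 (abs_nonneg _)
    linarith
  rw [logRatio, ← ofReal_measureReal, ENNReal.log_ofReal_of_pos (hpos r hr0), ← EReal.coe_div,
    EReal.coe_le_coe_iff, le_div_iff_of_neg hlr]
  exact hfin

lemma lowerLocalDim_le_upperLocalDim (μ : Measure (EuclideanSpace ℝ (Fin d)))
    (x : EuclideanSpace ℝ (Fin d)) : lowerLocalDim μ x ≤ upperLocalDim μ x :=
  liminf_le_limsup

section Moran

variable {M : ℕ}

/-- The point with binary expansion given, in blocks of length `M`, by the sequence `ω`. -/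
def digitPoint (ω : ℕ → Fin d → Fin (2 ^ M)) : EuclideanSpace ℝ (Fin d) :=
  WithLp.toLp 2 fun c => Real.ofDigits fun k => ω k c

lemma continuous_digitPoint : Continuous (digitPoint (d := d) (M := M)) := by
  refine (PiLp.continuous_toLp 2 _).comp (continuous_pi fun c => ?_)
  exact Real.continuous_ofDigits.comp
    (continuous_pi fun k => (continuous_apply c).comp (continuous_apply k))

lemma measurable_digitPoint : Measurable (digitPoint (d := d) (M := M)) :=
  continuous_digitPoint.measurable

/-- The integer whose base `2 ^ M` digits are the first `k` entries of `ω`. -/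
def digitPrefix : ℕ → (ℕ → Fin d → Fin (2 ^ M)) → Fin d → ℤ
  | 0, _ => 0
  | k + 1, ω => fun c => digitPrefix k ω c * 2 ^ M + ((ω k c : ℕ) : ℤ)

lemma digitPrefix_succ (k : ℕ) (ω : ℕ → Fin d → Fin (2 ^ M)) (c : Fin d) :
    digitPrefix (k + 1) ω c = digitPrefix k ω c * 2 ^ M + ((ω k c : ℕ) : ℤ) := rfl

/-- Integer part plus tail. The tail may equal one, so prefixes are not floors and both resulting
inequalities are non-strict. -/
lemma digitPrefix_add_ofDigits (k : ℕ) (ω : ℕ → Fin d → Fin (2 ^ M)) (c : Fin d) :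
    ((2 : ℝ) ^ M) ^ k * digitPoint ω c =
      digitPrefix k ω c + Real.ofDigits fun j => ω (j + k) c := by
  induction k with
  | zero => simp [digitPrefix, digitPoint]
  | succ k ih =>
    have h1 := Real.ofDigits_eq_sum_add_ofDigits (fun j => ω (j + k) c) 1
    simp only [Finset.sum_range_one, Real.ofDigitsTerm, zero_add, pow_one] at h1
    rw [pow_succ, mul_right_comm, ih, digitPrefix_succ, h1]
    push_cast
    have h2 : ∀ j, j + 1 + k = j + (k + 1) := fun j => by ring
    simp only [h2]
    field_simp
    ring

lemma digitPrefix_le (k : ℕ) (ω : ℕ → Fin d → Fin (2 ^ M)) (c : Fin d) :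
    (digitPrefix k ω c : ℝ) ≤ ((2 : ℝ) ^ M) ^ k * digitPoint ω c := by
  rw [digitPrefix_add_ofDigits]
  linarith [Real.ofDigits_nonneg fun j => ω (j + k) c]

lemma le_digitPrefix_add_one (k : ℕ) (ω : ℕ → Fin d → Fin (2 ^ M)) (c : Fin d) :
    ((2 : ℝ) ^ M) ^ k * digitPoint ω c ≤ digitPrefix k ω c + 1 := by
  rw [digitPrefix_add_ofDigits]
  linarith [Real.ofDigits_le_one fun j => ω (j + k) c]

lemma digitPrefix_eq_iff (k : ℕ) (ω ω' : ℕ → Fin d → Fin (2 ^ M)) :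
    digitPrefix k ω = digitPrefix k ω' ↔ ∀ j < k, ω j = ω' j := by
  induction k with
  | zero => simp [digitPrefix]
  | succ k ih =>
    rw [Nat.forall_lt_succ_right, ← ih]
    constructor
    · intro h
      have h1 : ∀ c, digitPrefix k ω c = digitPrefix k ω' c ∧ ω k c = ω' k c := by
        intro c
        have h2 := congrFun h c
        rw [digitPrefix_succ, digitPrefix_succ] at h2
        have b1 : ((ω k c : ℕ) : ℤ) < 2 ^ M := by exact_mod_cast (ω k c).2
        have b2 : ((ω' k c : ℕ) : ℤ) < 2 ^ M := by exact_mod_cast (ω' k c).2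
        have p : (0 : ℤ) < 2 ^ M := by positivity
        have h3 : digitPrefix k ω c = digitPrefix k ω' c := by
          have e1 := congrArg (· / (2 : ℤ) ^ M) h2
          simp only [add_comm (_ * (2 : ℤ) ^ M), Int.add_mul_ediv_right _ _ p.ne'] at e1
          rwa [Int.ediv_eq_zero_of_lt (by positivity) b1,
            Int.ediv_eq_zero_of_lt (by positivity) b2, zero_add, zero_add] at e1
        refine ⟨h3, ?_⟩
        rw [h3] at h2
        apply Fin.ext
        omega
      exact ⟨funext fun c => (h1 c).1, funext fun c => (h1 c).2⟩
    · rintro ⟨h1, h2⟩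
      funext c
      rw [digitPrefix_succ, digitPrefix_succ, h1, h2]

variable (A : ℕ → Finset (Fin d → Fin (2 ^ M))) (hA : ∀ k, (A k).Nonempty)

/-- The law of a sequence of independent digits, the `k`-th uniform on `A k`. -/
def digitLaw : Measure (ℕ → Fin d → Fin (2 ^ M)) :=
  Measure.infinitePi fun k => (PMF.uniformOfFinset (A k) (hA k)).toMeasure

instance : IsProbabilityMeasure (digitLaw A hA) := by
  unfold digitLaw; infer_instance

/-- The law of the point with independent digits, the `k`-th uniform on `A k`. -/
def moranMeasure : Measure (EuclideanSpace ℝ (Fin d)) :=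
  (digitLaw A hA).map digitPoint

instance : IsProbabilityMeasure (moranMeasure A hA) :=
  Measure.isProbabilityMeasure_map measurable_digitPoint.aemeasurable

lemma moranMeasure_apply {s : Set (EuclideanSpace ℝ (Fin d))} (hs : MeasurableSet s) :
    moranMeasure A hA s = digitLaw A hA (digitPoint ⁻¹' s) :=
  Measure.map_apply measurable_digitPoint hs

lemma digitLaw_prefix (k : ℕ) (ω : ℕ → Fin d → Fin (2 ^ M)) :
    digitLaw A hA {ω' | digitPrefix k ω' = digitPrefix k ω} =
      ∏ j ∈ Finset.range k, if ω j ∈ A j then ((A j).card : ℝ≥0∞)⁻¹ else 0 := by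
  have h1 : {ω' | digitPrefix k ω' = digitPrefix k ω} =
      Set.pi (Finset.range k : Set ℕ) fun j => {ω j} := by
    ext ω'
    simp [digitPrefix_eq_iff, Set.mem_pi]
  rw [h1, digitLaw, Measure.infinitePi_pi _ fun j _ => measurableSet_singleton _]
  refine Finset.prod_congr rfl fun j _ => ?_
  rw [PMF.toMeasure_apply_singleton _ _ (measurableSet_singleton _), PMF.uniformOfFinset_apply]
  split_ifs <;> rfl

lemma digitLaw_prefix_of_forall_mem (k : ℕ) {ω : ℕ → Fin d → Fin (2 ^ M)} (hω : ∀ j, ω j ∈ A j) :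
    digitLaw A hA {ω' | digitPrefix k ω' = digitPrefix k ω} =
      ENNReal.ofReal (∏ j ∈ Finset.range k, ((A j).card : ℝ))⁻¹ := by
  rw [digitLaw_prefix, ← Finset.prod_inv_distrib,
    ENNReal.ofReal_prod_of_nonneg fun j _ => by positivity]
  refine Finset.prod_congr rfl fun j _ => ?_
  rw [if_pos (hω j), ENNReal.ofReal_inv_of_pos (by exact_mod_cast (hA j).card_pos),
    ENNReal.ofReal_natCast]

lemma digitLaw_prefix_le (k : ℕ) (z : Fin d → ℤ) :
    digitLaw A hA {ω' | digitPrefix k ω' = z} ≤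
      ENNReal.ofReal (∏ j ∈ Finset.range k, ((A j).card : ℝ))⁻¹ := by
  by_cases h : ∃ ω : ℕ → Fin d → Fin (2 ^ M), digitPrefix k ω = z
  · obtain ⟨ω, rfl⟩ := h
    rw [digitLaw_prefix, ← Finset.prod_inv_distrib,
      ENNReal.ofReal_prod_of_nonneg fun j _ => by positivity]
    refine Finset.prod_le_prod' fun j _ => ?_
    rw [ENNReal.ofReal_inv_of_pos (by exact_mod_cast (hA j).card_pos), ENNReal.ofReal_natCast]
    split_ifs
    · exact le_rfl
    · exact zero_le
  · push Not at h
    have : {ω' : ℕ → Fin d → Fin (2 ^ M) | digitPrefix k ω' = z} = ∅ := by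
      ext ω; simp [h ω]
    rw [this, measure_empty]
    exact zero_le

lemma ae_digitLaw_forall_mem : ∀ᵐ ω ∂digitLaw A hA, ∀ k, ω k ∈ A k := by
  refine ae_all_iff.2 fun k => ?_
  have h1 := (measurePreserving_eval_infinitePi
    (fun k => (PMF.uniformOfFinset (A k) (hA k)).toMeasure) k)
  have h2 : ∀ᵐ v ∂(PMF.uniformOfFinset (A k) (hA k)).toMeasure, v ∈ A k := by
    rw [ae_iff]
    rw [PMF.toMeasure_apply_eq_zero_iff _ (Set.toFinite _).measurableSet]
    rw [PMF.support_uniformOfFinset]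
    exact Set.disjoint_left.2 fun v hv hv' => hv' hv
  exact h1.quasiMeasurePreserving.ae h2

/-- The set of points all of whose digits are admissible. -/
def moranSet : Set (EuclideanSpace ℝ (Fin d)) :=
  digitPoint '' {ω | ∀ k, ω k ∈ A k}

/-- The admissible sequences form a closed subset of a compact product, so their image is compact
and in particular measurable. -/
lemma ae_mem_moranSet : ∀ᵐ x ∂moranMeasure A hA, x ∈ moranSet A := by
  have h1 : IsCompact (moranSet A) := by
    refine IsCompact.image (IsClosed.isCompact ?_) continuous_digitPoint
    have : {ω : ℕ → Fin d → Fin (2 ^ M) | ∀ k, ω k ∈ A k} =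
        Set.pi Set.univ fun k => (A k : Set (Fin d → Fin (2 ^ M))) := by
      ext ω; simp [Set.mem_pi]
    rw [this]
    exact isClosed_set_pi fun k _ => (Set.toFinite _).isClosed
  refine (ae_map_iff measurable_digitPoint.aemeasurable h1.isClosed.measurableSet).2 ?_
  filter_upwards [ae_digitLaw_forall_mem A hA] with ω hω
  exact ⟨ω, hω, rfl⟩

lemma moranMeasure_eq_zero_of_disjoint {s : Set (EuclideanSpace ℝ (Fin d))}
    (h : ∀ x ∈ moranSet A, x ∉ s) : moranMeasure A hA s = 0 := by
  rw [measure_eq_zero_iff_ae_notMem]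
  filter_upwards [ae_mem_moranSet A hA] with x hx using h x hx

/-- The ball contains every point sharing the first `k` digits with the centre. -/
lemma inv_le_moranMeasure_closedBall (k : ℕ) {ω : ℕ → Fin d → Fin (2 ^ M)}
    (hω : ∀ j, ω j ∈ A j) :
    (∏ j ∈ Finset.range k, ((A j).card : ℝ))⁻¹ ≤
      (moranMeasure A hA).real (Metric.closedBall (digitPoint ω) (√d * (((2 : ℝ) ^ M) ^ k)⁻¹)) := by
  have h1 : {ω' : ℕ → Fin d → Fin (2 ^ M) | digitPrefix k ω' = digitPrefix k ω} ⊆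
      digitPoint ⁻¹' Metric.closedBall (digitPoint ω) (√d * (((2 : ℝ) ^ M) ^ k)⁻¹) := by
    intro ω' hω'
    refine dist_le_sqrt_mul (by positivity) fun c => ?_
    have hc : digitPrefix k ω' c = digitPrefix k ω c := congrFun hω' c
    have a1 := digitPrefix_le k ω c
    have a2 := le_digitPrefix_add_one k ω c
    have a3 := digitPrefix_le k ω' c
    have a4 := le_digitPrefix_add_one k ω' c
    rw [hc] at a3 a4
    rw [← one_div, le_div_iff₀ (by positivity), ← abs_of_pos (by positivity : 0 < ((2 : ℝ) ^ M) ^ k),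
      ← abs_mul, abs_le]
    constructor <;> linarith
  have h2 := measure_mono (μ := digitLaw A hA) h1
  rw [digitLaw_prefix_of_forall_mem A hA k hω,
    ← moranMeasure_apply A hA Metric.isClosed_closedBall.measurableSet] at h2
  exact (ENNReal.ofReal_le_iff_le_toReal (measure_ne_top _ _)).1 h2

lemma moranMeasure_closedBall_le (k : ℕ) (x : EuclideanSpace ℝ (Fin d)) :
    (moranMeasure A hA).real (Metric.closedBall x (((2 : ℝ) ^ M) ^ k)⁻¹) ≤
      4 ^ d * (∏ j ∈ Finset.range k, ((A j).card : ℝ))⁻¹ := by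
  set b : ℝ := ((2 : ℝ) ^ M) ^ k with hb
  have hb0 : 0 < b := by positivity
  -- Possible prefixes of points in the ball: one unit for the radius and one more below for the
  -- tail, an interval of length `3` with at most `4` integers.
  set T : Finset (Fin d → ℤ) := Fintype.piFinset fun c => Finset.Icc ⌈b * x c - 2⌉ ⌊b * x c + 1⌋
  have hT : T.card ≤ 4 ^ d := by
    rw [Fintype.card_piFinset]
    calc ∏ c, (Finset.Icc ⌈b * x c - 2⌉ ⌊b * x c + 1⌋).card ≤ ∏ _c : Fin d, 4 := by
          refine Finset.prod_le_prod' fun c _ => ?_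
          rw [Int.card_Icc]
          have h1 := Int.le_ceil (b * x c - 2)
          have h2 := Int.floor_le (b * x c + 1)
          have h3 : ((⌊b * x c + 1⌋ : ℤ) : ℝ) ≤ ((⌈b * x c - 2⌉ + 3 : ℤ) : ℝ) := by
            push_cast; linarith
          have h4 : ⌊b * x c + 1⌋ ≤ ⌈b * x c - 2⌉ + 3 := by exact_mod_cast h3
          omega
      _ = 4 ^ d := by simp
  have h1 : digitPoint ⁻¹' Metric.closedBall x b⁻¹ ⊆
      ⋃ z ∈ T, {ω' : ℕ → Fin d → Fin (2 ^ M) | digitPrefix k ω' = z} := by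
    intro ω hω
    have hω : dist (digitPoint ω) x ≤ b⁻¹ := hω
    simp only [Set.mem_iUnion]
    refine ⟨digitPrefix k ω, ?_, rfl⟩
    refine Fintype.mem_piFinset.2 fun c => ?_
    have a1 := digitPrefix_le k ω c
    have a2 := le_digitPrefix_add_one k ω c
    have a3 := (abs_coord_sub_le_dist (digitPoint ω) x c).trans hω
    rw [← one_div, le_div_iff₀ hb0, ← abs_of_pos hb0, ← abs_mul, abs_le] at a3
    rw [Finset.mem_Icc, Int.ceil_le, Int.le_floor]
    constructor <;> linarith [a3.1, a3.2]
  have h2 : moranMeasure A hA (Metric.closedBall x b⁻¹) ≤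
      ENNReal.ofReal (4 ^ d * (∏ j ∈ Finset.range k, ((A j).card : ℝ))⁻¹) := by
    rw [moranMeasure_apply A hA Metric.isClosed_closedBall.measurableSet]
    calc _ ≤ _ := measure_mono h1
      _ ≤ ∑ z ∈ T, digitLaw A hA {ω' | digitPrefix k ω' = z} := measure_biUnion_finset_le _ _
      _ ≤ ∑ z ∈ T, ENNReal.ofReal (∏ j ∈ Finset.range k, ((A j).card : ℝ))⁻¹ :=
          Finset.sum_le_sum fun z _ => digitLaw_prefix_le A hA k z
      _ = (T.card : ℝ≥0∞) * ENNReal.ofReal (∏ j ∈ Finset.range k, ((A j).card : ℝ))⁻¹ := by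
          rw [Finset.sum_const, nsmul_eq_mul]
      _ ≤ ENNReal.ofReal (4 ^ d) * ENNReal.ofReal (∏ j ∈ Finset.range k, ((A j).card : ℝ))⁻¹ := by
          gcongr
          rw [← ENNReal.ofReal_natCast]
          exact ENNReal.ofReal_le_ofReal (by exact_mod_cast hT)
      _ = _ := (ENNReal.ofReal_mul (by positivity)).symm
  exact ENNReal.toReal_le_of_le_ofReal (mul_nonneg (by positivity)
    (inv_nonneg.2 (Finset.prod_nonneg fun _ _ => Nat.cast_nonneg _))) h2

end Moran

end MeanPorosity

/-! ### Block constructions: frequency of porous scales and dimension -/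

namespace MeanPorosity

variable {d : ℕ}

/-- A set of natural numbers of density `θ`, for `0 ≤ θ ≤ 1`. -/
def IsSelected (θ : ℝ) (k : ℕ) : Prop := ⌊(k : ℝ) * θ⌋₊ < ⌊((k : ℝ) + 1) * θ⌋₊

open Classical in
lemma card_filter_isSelected {θ : ℝ} (h0 : 0 ≤ θ) (h1 : θ ≤ 1) (K : ℕ) :
    ((Finset.range K).filter (IsSelected θ)).card = ⌊(K : ℝ) * θ⌋₊ := by
  induction K with
  | zero => simp
  | succ K ih =>
    rw [Finset.range_add_one, Finset.filter_insert]
    have hmono : ⌊(K : ℝ) * θ⌋₊ ≤ ⌊((K : ℝ) + 1) * θ⌋₊ := Nat.floor_mono (by linarith)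
    have hle : ⌊((K : ℝ) + 1) * θ⌋₊ ≤ ⌊(K : ℝ) * θ⌋₊ + 1 := by
      rw [← Nat.floor_add_one (by positivity)]
      exact Nat.floor_mono (by linarith)
    push_cast
    split_ifs with h
    · rw [Finset.card_insert_of_notMem (by simp), ih]
      have h : ⌊(K : ℝ) * θ⌋₊ < ⌊((K : ℝ) + 1) * θ⌋₊ := h
      omega
    · have h : ¬ ⌊(K : ℝ) * θ⌋₊ < ⌊((K : ℝ) + 1) * θ⌋₊ := h
      rw [ih]; omega

-- Each selected complete block below `N` supplies `R.card` indices; translating by `q` loses at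
-- most the first `q` of them.
open Classical in
lemma mul_floor_le_card_filter_isSelected {θ : ℝ} (h0 : 0 ≤ θ) (h1 : θ ≤ 1) {M : ℕ} (hM : 1 ≤ M)
    (R : Finset ℕ) (hR : ∀ r ∈ R, r < M) (q N : ℕ) :
    R.card * ⌊((N / M : ℕ) : ℝ) * θ⌋₊ ≤
      ((Finset.range N).filter fun i => IsSelected θ ((i + q) / M) ∧ (i + q) % M ∈ R).card + q := by
  rw [← card_filter_isSelected h0 h1, mul_comm, ← Finset.card_product]
  set S := (Finset.range N).filter fun n => IsSelected θ (n / M) ∧ n % M ∈ R with hS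
  have hcard : ((Finset.range (N / M)).filter (IsSelected θ) ×ˢ R).card ≤ S.card := by
    refine Finset.card_le_card_of_injOn (fun p => p.2 + M * p.1) ?_ ?_
    · rintro ⟨k, r⟩ hkr
      simp only [Finset.coe_product, Set.mem_prod, Finset.mem_coe, Finset.mem_filter,
        Finset.mem_range] at hkr
      obtain ⟨⟨hk, hsel⟩, hr⟩ := hkr
      have hrM := hR r hr
      have e1 : (r + M * k) / M = k := by
        rw [Nat.add_mul_div_left _ _ (by omega), Nat.div_eq_of_lt hrM, zero_add]
      have e2 : (r + M * k) % M = r := by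
        rw [Nat.add_mul_mod_self_left, Nat.mod_eq_of_lt hrM]
      simp only [hS, Finset.coe_filter, Finset.mem_range]
      refine ⟨?_, by rwa [e1], by rwa [e2]⟩
      have h2 : M * (k + 1) ≤ M * (N / M) := Nat.mul_le_mul_left _ hk
      have h3 := Nat.mul_div_le N M
      rw [Nat.mul_add, Nat.mul_one] at h2
      omega
    · rintro ⟨k, r⟩ hkr ⟨k', r'⟩ hkr' heq
      simp only [Finset.coe_product, Set.mem_prod, Finset.mem_coe] at hkr hkr'
      have hr := hR r hkr.2
      have hr' := hR r' hkr'.2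
      simp only at heq
      have e1 := congrArg (· / M) heq
      have e2 := congrArg (· % M) heq
      simp only [Nat.add_mul_div_left _ _ (show 0 < M by omega), Nat.div_eq_of_lt hr,
        Nat.div_eq_of_lt hr', zero_add, Nat.add_mul_mod_self_left, Nat.mod_eq_of_lt hr,
        Nat.mod_eq_of_lt hr'] at e1 e2
      rw [e1, e2]
  refine hcard.trans ?_
  have hsub : S ⊆ (((Finset.range N).filter fun i =>
      IsSelected θ ((i + q) / M) ∧ (i + q) % M ∈ R).image (· + q)) ∪ Finset.range q := by
    intro n hn
    simp only [hS, Finset.mem_filter, Finset.mem_range] at hn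
    simp only [Finset.mem_union, Finset.mem_image, Finset.mem_filter, Finset.mem_range]
    by_cases hq : n < q
    · exact Or.inr hq
    · refine Or.inl ⟨n - q, ⟨by omega, ?_⟩, by omega⟩
      rw [show n - q + q = n by omega]
      exact hn.2
  calc S.card ≤ _ := Finset.card_le_card hsub
    _ ≤ _ := Finset.card_union_le _ _
    _ ≤ _ := by
        rw [Finset.card_range]
        exact Nat.add_le_add_right Finset.card_image_le q

/-- Porosity at all scales with residue in `R` in a proportion `θ` of the blocks of `M` scales
implies mean porosity. -/
lemma isMeanPorous_of_isSelected {θ : ℝ} (h0 : 0 ≤ θ) (h1 : θ ≤ 1) {M : ℕ} (hM : 1 ≤ M)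
    (R : Finset ℕ) (hR : ∀ r ∈ R, r < M) (q : ℕ) {α η : ℝ} (hη : η ≤ R.card * θ / M)
    (μ : Measure (EuclideanSpace ℝ (Fin d)))
    (h : ∀ ε > 0, ∀ᵐ x ∂μ, ∀ i : ℕ, IsSelected θ ((i + q) / M) → (i + q) % M ∈ R →
      α ≤ por μ x ((2 : ℝ)⁻¹ ^ i) ε) : IsMeanPorous μ α η := by
  classical
  intro ε hε
  filter_upwards [h ε hε] with x hx
  refine le_of_forall_lt fun η' hη' => ?_
  obtain ⟨η'', hη1, hη2⟩ := exists_between hη'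
  refine hη1.trans_le ?_
  have hM0 : (0 : ℝ) < M := by exact_mod_cast hM
  refine le_liminf_of_le ?_ ?_
  · refine IsBoundedUnder.isCoboundedUnder_ge (isBoundedUnder_of ⟨1, fun n => ?_⟩)
    refine div_le_one_of_le₀ ?_ (by positivity)
    have := Finset.card_filter_le (Finset.range n) fun i : ℕ => α ≤ por μ x ((2 : ℝ)⁻¹ ^ i) ε
    rw [Finset.card_range] at this
    exact_mod_cast this
  · have hE := eventually_log_add_le 0 (R.card * (θ + 1) + q) (show 0 < η - η'' by linarith)
    filter_upwards [hE, eventually_gt_atTop 0] with N hN hN0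
    have hN0' : (0 : ℝ) < N := by exact_mod_cast hN0
    rw [porousProportion, le_div_iff₀ hN0']
    have h2 := mul_floor_le_card_filter_isSelected h0 h1 hM R hR q N
    have h3 : ((Finset.range N).filter fun i =>
        IsSelected θ ((i + q) / M) ∧ (i + q) % M ∈ R).card ≤
        ((Finset.range N).filter fun i : ℕ => α ≤ por μ x ((2 : ℝ)⁻¹ ^ i) ε).card := by
      refine Finset.card_le_card (Finset.monotone_filter_right _ ?_)
      intro i _ hi
      exact hx i hi.1 hi.2
    have h4 : ((R.card * ⌊((N / M : ℕ) : ℝ) * θ⌋₊ : ℕ) : ℝ) ≤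
      (((Finset.range N).filter fun i : ℕ => α ≤ por μ x ((2 : ℝ)⁻¹ ^ i) ε).card + q : ℕ) := by
      exact_mod_cast h2.trans (Nat.add_le_add_right h3 q)
    push_cast at h4
    have h5 : ((N / M : ℕ) : ℝ) * θ - 1 ≤ ⌊((N / M : ℕ) : ℝ) * θ⌋₊ :=
      (Nat.sub_one_lt_floor _).le
    have h6 : (N : ℝ) / M - 1 ≤ ((N / M : ℕ) : ℝ) := by
      rw [← Nat.floor_div_eq_div (K := ℝ)]
      exact (Nat.sub_one_lt_floor _).le
    have h7 : (R.card : ℝ) * (((N : ℝ) / M - 1) * θ - 1) ≤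
        R.card * (⌊((N / M : ℕ) : ℝ) * θ⌋₊ : ℝ) := by
      refine mul_le_mul_of_nonneg_left ?_ (by positivity)
      have := mul_le_mul_of_nonneg_right h6 h0
      linarith
    have h8 : η * N ≤ R.card * θ / M * N := mul_le_mul_of_nonneg_right hη hN0'.le
    have h9 : (R.card : ℝ) * (((N : ℝ) / M - 1) * θ - 1) =
        R.card * θ / M * N - R.card * (θ + 1) := by field_simp; ring
    linarith

section Moran

variable {M : ℕ}

open Classical in
/-- The sets of admissible digits: `A` for a proportion `θ` of the digits, and no restriction
for the other digits. -/
def blockDigits (A : Finset (Fin d → Fin (2 ^ M))) (θ : ℝ) (k : ℕ) :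
    Finset (Fin d → Fin (2 ^ M)) :=
  if IsSelected θ k then A else Finset.univ

variable {A : Finset (Fin d → Fin (2 ^ M))} {θ : ℝ}

lemma blockDigits_of_isSelected {k : ℕ} (h : IsSelected θ k) : blockDigits A θ k = A := if_pos h

lemma blockDigits_nonempty (hA : A.Nonempty) (θ : ℝ) (k : ℕ) : (blockDigits A θ k).Nonempty := by
  unfold blockDigits
  split_ifs
  · exact hA
  · exact Finset.univ_nonempty

lemma log_prod_card_blockDigits (hA : A.Nonempty) (h0 : 0 ≤ θ) (h1 : θ ≤ 1) (K : ℕ) :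
    Real.log (∏ k ∈ Finset.range K, ((blockDigits A θ k).card : ℝ)) =
      K * (M * d * Real.log 2) - ⌊(K : ℝ) * θ⌋₊ * (M * d * Real.log 2 - Real.log A.card) := by
  classical
  rw [Real.log_prod fun k _ => by
    have := (blockDigits_nonempty hA θ k).card_pos
    positivity]
  have h2 : ∀ k ∈ Finset.range K, Real.log ((blockDigits A θ k).card : ℝ) =
      M * d * Real.log 2 -
        (if IsSelected θ k then (M * d * Real.log 2 - Real.log A.card) else 0) := by
    intro k _
    unfold blockDigits
    split_ifs
    · ring
    · rw [Finset.card_univ, Fintype.card_fun, Fintype.card_fin, Fintype.card_fin]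
      push_cast
      rw [Real.log_pow, Real.log_pow]
      ring
  rw [Finset.sum_congr rfl h2, Finset.sum_sub_distrib, ← Finset.sum_filter, Finset.sum_const,
    Finset.sum_const, card_filter_isSelected h0 h1, Finset.card_range, nsmul_eq_mul, nsmul_eq_mul]

/-- The dimension of the measure with independent digits, uniform on `A` for a proportion `θ` of
the digits. -/
def moranDim (A : Finset (Fin d → Fin (2 ^ M))) (θ : ℝ) : ℝ :=
  d - θ * (d - Real.log A.card / (M * Real.log 2))

/-- At every admissible point, balls at block scale `K` have mass comparable to the reciprocal of
the number of admissible prefixes, and the logarithm `S K` of that number is linear in `K` up to the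
bounded error `lam`. So upper and lower local dimensions agree. -/
lemma localDim_moranMeasure (hd : 1 ≤ d) (hM : 1 ≤ M) (hA : A.Nonempty) (h0 : 0 ≤ θ) (h1 : θ ≤ 1)
    {x : EuclideanSpace ℝ (Fin d)} (hx : x ∈ moranSet (blockDigits A θ)) :
    upperLocalDim (moranMeasure (blockDigits A θ) (blockDigits_nonempty hA θ)) x = moranDim A θ ∧
    lowerLocalDim (moranMeasure (blockDigits A θ) (blockDigits_nonempty hA θ)) x =
      moranDim A θ := by
  obtain ⟨ω, hω, rfl⟩ := hx
  set μ := moranMeasure (blockDigits A θ) (blockDigits_nonempty hA θ) with hμ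
  have hlog : 0 < Real.log 2 := Real.log_pos (by norm_num)
  have hM0 : (0 : ℝ) < M := by exact_mod_cast hM
  have hd' : (1 : ℝ) ≤ d := by exact_mod_cast hd
  have hs : 1 ≤ √(d : ℝ) := Real.one_le_sqrt.2 hd'
  set S : ℕ → ℝ := fun K => Real.log (∏ k ∈ Finset.range K, ((blockDigits A θ k).card : ℝ)) with hS
  set lam : ℝ := M * d * Real.log 2 - Real.log A.card with hlam
  have hlA : 0 ≤ Real.log A.card := Real.log_natCast_nonneg _
  have hlam0 : 0 ≤ lam := by
    have h2 : (A.card : ℝ) ≤ ((2 ^ M) ^ d : ℕ) := by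
      have := Finset.card_le_univ A
      rw [Fintype.card_fun, Fintype.card_fin, Fintype.card_fin] at this
      exact_mod_cast this
    have h3 := Real.log_le_log (by have := hA.card_pos; positivity) h2
    push_cast at h3
    rw [Real.log_pow, Real.log_pow] at h3
    rw [hlam]; linarith
  have hdim : moranDim A θ * (M * Real.log 2) = M * d * Real.log 2 - θ * lam := by
    rw [moranDim, hlam]; field_simp
  have hdim0 : 0 ≤ moranDim A θ := by
    have : 0 ≤ moranDim A θ * (M * Real.log 2) := by rw [hdim]; nlinarith
    exact nonneg_of_mul_nonneg_left this (by positivity)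
  have hS1 : ∀ K, S K ≤ K * (moranDim A θ * (M * Real.log 2)) + lam := by
    intro K
    simp only [hS]
    rw [log_prod_card_blockDigits hA h0 h1, hdim]
    have := mul_le_mul_of_nonneg_right (Nat.sub_one_lt_floor ((K : ℝ) * θ)).le hlam0
    linarith
  have hS2 : ∀ K, K * (moranDim A θ * (M * Real.log 2)) ≤ S K := by
    intro K
    simp only [hS]
    rw [log_prod_card_blockDigits hA h0 h1, hdim]
    have := mul_le_mul_of_nonneg_right (Nat.floor_le (show 0 ≤ (K : ℝ) * θ by positivity)) hlam0
    linarith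
  have hprod : ∀ K, 0 < ∏ k ∈ Finset.range K, ((blockDigits A θ k).card : ℝ) := fun K =>
    Finset.prod_pos fun k _ => by exact_mod_cast (blockDigits_nonempty hA θ k).card_pos
  have hlow : ∀ K N : ℕ, N ≤ M * K →
      -S K ≤ Real.log (μ.real (Metric.closedBall (digitPoint ω) (√d * (2 : ℝ)⁻¹ ^ N))) := by
    intro K N hN
    simp only [hS]
    rw [← Real.log_inv]
    refine Real.log_le_log (inv_pos.2 (hprod K)) ?_
    refine (inv_le_moranMeasure_closedBall _ (blockDigits_nonempty hA θ) K hω).trans ?_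
    refine measureReal_mono (Metric.closedBall_subset_closedBall ?_)
    rw [← pow_mul, ← inv_pow]
    exact mul_le_mul_of_nonneg_left (pow_le_pow_of_le_one (by norm_num) (by norm_num) hN)
      (by positivity)
  have hpos : ∀ r > 0, 0 < μ.real (Metric.closedBall (digitPoint ω) r) := by
    intro r hr
    obtain ⟨N, hN⟩ := exists_pow_lt_of_lt_one (show 0 < r / √d by positivity)
      (show (2 : ℝ)⁻¹ < 1 by norm_num)
    rw [lt_div_iff₀ (by positivity), mul_comm] at hN
    refine lt_of_lt_of_le (inv_pos.2 (hprod N)) ?_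
    refine (inv_le_moranMeasure_closedBall _ (blockDigits_nonempty hA θ) N hω).trans ?_
    refine measureReal_mono (Metric.closedBall_subset_closedBall (le_trans ?_ hN.le))
    rw [← pow_mul, ← inv_pow]
    exact mul_le_mul_of_nonneg_left (pow_le_pow_of_le_one (by norm_num) (by norm_num)
      (Nat.le_mul_of_pos_left N hM)) (by positivity)
  have hup : ∀ K N : ℕ, M * K ≤ N →
      Real.log (μ.real (Metric.closedBall (digitPoint ω) ((2 : ℝ)⁻¹ ^ N))) ≤
        d * Real.log 4 - S K := by
    intro K N hN
    have h2 : μ.real (Metric.closedBall (digitPoint ω) ((2 : ℝ)⁻¹ ^ N)) ≤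
        4 ^ d * (∏ j ∈ Finset.range K, ((blockDigits A θ j).card : ℝ))⁻¹ := by
      refine le_trans (measureReal_mono (Metric.closedBall_subset_closedBall ?_))
        (moranMeasure_closedBall_le _ (blockDigits_nonempty hA θ) K _)
      rw [← pow_mul, ← inv_pow]
      exact pow_le_pow_of_le_one (by norm_num) (by norm_num) hN
    have h3 := Real.log_le_log (hpos _ (by positivity)) h2
    rwa [Real.log_mul (by positivity) (inv_pos.2 (hprod K)).ne', Real.log_inv, Real.log_pow,
      ← sub_eq_add_neg] at h3
  have hU : upperLocalDim μ (digitPoint ω) ≤ moranDim A θ := by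
    refine EReal.le_of_forall_lt_iff_le.1 fun s' hs' => ?_
    rw [EReal.coe_lt_coe_iff] at hs'
    obtain ⟨s, hs1, hs2⟩ := exists_between hs'
    refine upperLocalDim_le hd μ hs2 hpos ?_
    have hE := eventually_log_add_le 0 (M * Real.log 2 * moranDim A θ + lam)
      (mul_pos (sub_pos.2 hs1) hlog)
    filter_upwards [hE] with N hN
    have h2 := hlow (N / M + 1) N (Nat.lt_mul_div_succ N hM).le
    have h3 := hS1 (N / M + 1)
    have h4 : (((N / M : ℕ) : ℝ)) * M ≤ N := by exact_mod_cast Nat.div_mul_le_self N M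
    have h5 := mul_le_mul_of_nonneg_right h4 (mul_nonneg hdim0 hlog.le)
    push_cast at h3
    linarith
  have hL : (moranDim A θ : EReal) ≤ lowerLocalDim μ (digitPoint ω) := by
    refine EReal.ge_of_forall_gt_iff_ge.1 fun s' hs' => ?_
    rw [EReal.coe_lt_coe_iff] at hs'
    obtain ⟨s, hs1, hs2⟩ := exists_between hs'
    refine le_lowerLocalDim μ hs1 hpos ?_
    have hE := eventually_log_add_le 0 (M * Real.log 2 * moranDim A θ + d * Real.log 4)
      (mul_pos (sub_pos.2 hs2) hlog)
    filter_upwards [hE] with N hN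
    have h2 := hup (N / M) N (Nat.mul_div_le N M)
    have h3 := hS2 (N / M)
    have h4 : (N : ℝ) ≤ (((N / M : ℕ) : ℝ)) * M + M := by
      have := (Nat.lt_mul_div_succ N hM).le
      have h6 : (N : ℝ) ≤ ((M * (N / M + 1) : ℕ) : ℝ) := by exact_mod_cast this
      push_cast at h6
      linarith
    have h5 := mul_le_mul_of_nonneg_right h4 (mul_nonneg hdim0 hlog.le)
    linarith
  have hLU := lowerLocalDim_le_upperLocalDim μ (digitPoint ω)
  exact ⟨le_antisymm hU (hL.trans hLU), le_antisymm (hLU.trans hU) hL⟩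

lemma dim_moranMeasure (hd : 1 ≤ d) (hM : 1 ≤ M) (hA : A.Nonempty) (h0 : 0 ≤ θ) (h1 : θ ≤ 1) :
    packingDim (moranMeasure (blockDigits A θ) (blockDigits_nonempty hA θ)) = moranDim A θ ∧
    hausdorffDim (moranMeasure (blockDigits A θ) (blockDigits_nonempty hA θ)) = moranDim A θ := by
  set μ := moranMeasure (blockDigits A θ) (blockDigits_nonempty hA θ) with hμ
  have hae := ae_mem_moranSet (blockDigits A θ) (blockDigits_nonempty hA θ)
  rw [← hμ] at hae
  have hne : μ ≠ 0 := IsProbabilityMeasure.ne_zero μ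
  constructor
  · have : upperLocalDim μ =ᵐ[μ] fun _ => (moranDim A θ : EReal) := by
      filter_upwards [hae] with x hx using (localDim_moranMeasure hd hM hA h0 h1 hx).1
    rw [packingDim, essSup_congr_ae this, essSup_const _ hne]
  · have : lowerLocalDim μ =ᵐ[μ] fun _ => (moranDim A θ : EReal) := by
      filter_upwards [hae] with x hx using (localDim_moranMeasure hd hM hA h0 h1 hx).2
    rw [hausdorffDim, essSup_congr_ae this, essSup_const _ hne]

end Moran

/-- A ball of measure zero shows porosity. -/
lemma le_por (hd : 1 ≤ d) {μ : Measure (EuclideanSpace ℝ (Fin d))}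
    {x y : EuclideanSpace ℝ (Fin d)} {r ε α : ℝ} (hr : 0 < r) (hα : 0 ≤ α)
    (hsub : Metric.closedBall y (α * r) ⊆ Metric.closedBall x r)
    (h0 : μ (Metric.closedBall y (α * r)) = 0) : α ≤ por μ x r ε := by
  have : Nonempty (Fin d) := ⟨⟨0, hd⟩⟩
  -- The supremum of an unbounded set would be `0`. Comparing diameters bounds the radii by `1`,
  -- which uses positive dimension.
  refine le_csSup ⟨1, ?_⟩ ⟨hα, ?_⟩
  · rintro β ⟨hβ0, hβ⟩
    obtain ⟨z, hz⟩ := iInf_lt_iff.1 (hβ.trans_lt ENNReal.ofReal_lt_top)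
    obtain ⟨hz, -⟩ := iInf_lt_iff.1 hz
    have h1 := Metric.diam_mono hz Metric.isBounded_closedBall
    rw [Metric.diam_closedBall_eq _ (by positivity), Metric.diam_closedBall_eq _ hr.le] at h1
    have : β * r ≤ 1 * r := by linarith
    exact le_of_mul_le_mul_right this hr
  · refine (iInf₂_le y hsub).trans ?_
    rw [h0, ENNReal.zero_div]
    exact zero_le

end MeanPorosity

/-! ### Digit sets that create porosity -/

namespace MeanPorosity

variable {d : ℕ}

section Moran

variable {M : ℕ}

/-- Strictness on both sides removes the ambiguity of points with two expansions. -/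
lemma digitPrefix_eq_of_mem_open_cube {k : ℕ} {ω : ℕ → Fin d → Fin (2 ^ M)} {z : Fin d → ℤ}
    (h1 : ∀ c, (z c : ℝ) < ((2 : ℝ) ^ M) ^ k * digitPoint ω c)
    (h2 : ∀ c, ((2 : ℝ) ^ M) ^ k * digitPoint ω c < z c + 1) : digitPrefix k ω = z := by
  funext c
  have a1 := digitPrefix_le k ω c
  have a2 := le_digitPrefix_add_one k ω c
  have b1 : (digitPrefix k ω c : ℝ) < ((z c + 1 : ℤ) : ℝ) := by push_cast; linarith [h2 c]
  have b2 : (z c : ℝ) < ((digitPrefix k ω c + 1 : ℤ) : ℝ) := by push_cast; linarith [h1 c]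
  have b1 : digitPrefix k ω c < z c + 1 := by exact_mod_cast b1
  have b2 : z c < digitPrefix k ω c + 1 := by exact_mod_cast b2
  omega

lemma abs_digitPoint_sub_le {k : ℕ} {ω ω' : ℕ → Fin d → Fin (2 ^ M)}
    (h : digitPrefix k ω = digitPrefix k ω') (c : Fin d) :
    |digitPoint ω c - digitPoint ω' c| ≤ (2 : ℝ)⁻¹ ^ (M * k) := by
  have a1 := digitPrefix_le k ω c
  have a2 := le_digitPrefix_add_one k ω c
  have a3 := digitPrefix_le k ω' c
  have a4 := le_digitPrefix_add_one k ω' c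
  rw [h] at a1 a2
  have p : (0 : ℝ) < (2 ^ M) ^ k := by positivity
  rw [inv_pow, pow_mul, ← one_div, le_div_iff₀ p, ← abs_of_pos p, ← abs_mul, abs_le]
  constructor <;> linarith

/-- Divisibility says that the bits `e, …, e + m - 1` vanish, so the bits above and below them
determine `v`. -/
lemma card_filter_dvd_div_le {e m : ℕ} (h : e + m ≤ M) :
    (Finset.univ.filter fun v : Fin (2 ^ M) => 2 ^ m ∣ (v : ℕ) / 2 ^ e).card ≤ 2 ^ (M - m) := by
  have hc : 2 ^ (M - m) = (Finset.range (2 ^ (M - (e + m))) ×ˢ Finset.range (2 ^ e)).card := by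
    rw [Finset.card_product, Finset.card_range, Finset.card_range, ← pow_add]
    congr 1; omega
  rw [hc]
  refine Finset.card_le_card_of_injOn (fun v => ((v : ℕ) / 2 ^ (e + m), (v : ℕ) % 2 ^ e)) ?_ ?_
  · intro v _
    simp only [Finset.coe_product, Set.mem_prod, Finset.mem_coe, Finset.mem_range]
    refine ⟨?_, Nat.mod_lt _ (by positivity)⟩
    rw [Nat.div_lt_iff_lt_mul (by positivity), ← pow_add, show M - (e + m) + (e + m) = M by omega]
    exact v.2
  · intro v hv v' hv' heq
    simp only [Finset.coe_filter, Finset.mem_univ, true_and] at hv hv'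
    have hv : 2 ^ m ∣ (v : ℕ) / 2 ^ e := hv
    have hv' : 2 ^ m ∣ (v' : ℕ) / 2 ^ e := hv'
    rw [Prod.mk.injEq, pow_add, ← Nat.div_div_eq_div_mul, ← Nat.div_div_eq_div_mul] at heq
    obtain ⟨h1, h2⟩ := heq
    have h3 : (v : ℕ) / 2 ^ e = v' / 2 ^ e := by
      rw [← Nat.mul_div_cancel' hv, ← Nat.mul_div_cancel' hv', h1]
    apply Fin.ext
    rw [← Nat.div_add_mod (v : ℕ) (2 ^ e), ← Nat.div_add_mod (v' : ℕ) (2 ^ e), h2, h3]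

lemma card_filter_forall_dvd_div_le {e m : ℕ} (h : e + m ≤ M) :
    (Finset.univ.filter fun v : Fin d → Fin (2 ^ M) => ∀ c, 2 ^ m ∣ (v c : ℕ) / 2 ^ e).card ≤
      2 ^ ((M - m) * d) := by
  have h1 : (Finset.univ.filter fun v : Fin d → Fin (2 ^ M) => ∀ c, 2 ^ m ∣ (v c : ℕ) / 2 ^ e) =
      Fintype.piFinset fun _ => Finset.univ.filter fun v : Fin (2 ^ M) =>
        2 ^ m ∣ (v : ℕ) / 2 ^ e := by
    ext v; simp
  rw [h1, Fintype.card_piFinset, pow_mul]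
  calc _ ≤ ∏ _c : Fin d, 2 ^ (M - m) := Finset.prod_le_prod' fun c _ => card_filter_dvd_div_le h
    _ = _ := by simp

variable (d M) in
open Classical in
/-- The blocks of `M` binary digit vectors without `m` consecutive zero vectors and whose last
vector is not zero. -/
def sparseDigits (m : ℕ) : Finset (Fin d → Fin (2 ^ M)) :=
  Finset.univ.filter fun v => (∃ c, ¬ 2 ∣ (v c : ℕ)) ∧
    ∀ e, e + m ≤ M → ∃ c, ¬ 2 ^ m ∣ (v c : ℕ) / 2 ^ e

lemma mem_sparseDigits {m : ℕ} {v : Fin d → Fin (2 ^ M)} : v ∈ sparseDigits d M m ↔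
    (∃ c, ¬ 2 ∣ (v c : ℕ)) ∧ ∀ e, e + m ≤ M → ∃ c, ¬ 2 ^ m ∣ (v c : ℕ) / 2 ^ e := by
  simp only [sparseDigits, Finset.mem_filter, Finset.mem_univ, true_and]

/-- A union bound: a zero last vector excludes at most half of the blocks, and the at most `M`
windows, each excluding a proportion `2 ^ (-m d)`, at most a quarter. -/
lemma card_sparseDigits (hd : 1 ≤ d) {m : ℕ} (hm : 1 ≤ m) (hM : 1 ≤ M)
    (hMm : 4 * M ≤ 2 ^ (m * d)) :
    2 ^ (M * d) ≤ 4 * (sparseDigits d M m).card := by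
  classical
  set E := Finset.univ.filter fun v : Fin d → Fin (2 ^ M) => ∀ c, 2 ^ 1 ∣ (v c : ℕ) / 2 ^ 0 with hE
  set F : ℕ → Finset (Fin d → Fin (2 ^ M)) := fun e =>
    Finset.univ.filter fun v : Fin d → Fin (2 ^ M) => ∀ c, 2 ^ m ∣ (v c : ℕ) / 2 ^ e with hF
  set J := (Finset.range M).filter fun e => e + m ≤ M with hJ
  have hcover : (Finset.univ : Finset (Fin d → Fin (2 ^ M))) ⊆
      sparseDigits d M m ∪ (E ∪ J.biUnion F) := by
    intro v _
    by_contra hv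
    simp only [Finset.mem_union, not_or, Finset.mem_biUnion, not_exists, not_and] at hv
    obtain ⟨h1, h2, h3⟩ := hv
    refine h1 ?_
    refine mem_sparseDigits.2 ⟨?_, fun e he => ?_⟩
    · by_contra hcon
      push Not at hcon
      refine h2 ?_
      rw [hE, Finset.mem_filter]
      exact ⟨Finset.mem_univ _, by simpa using hcon⟩
    · by_contra hcon
      push Not at hcon
      refine h3 e ?_ ?_
      · rw [hJ, Finset.mem_filter, Finset.mem_range]
        exact ⟨by omega, he⟩
      · rw [hF, Finset.mem_filter]
        exact ⟨Finset.mem_univ _, hcon⟩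
  have h1 : 2 ^ (M * d) ≤ (sparseDigits d M m).card + (E.card + (J.biUnion F).card) := by
    calc 2 ^ (M * d) = (Finset.univ : Finset (Fin d → Fin (2 ^ M))).card := by
          rw [Finset.card_univ, Fintype.card_fun, Fintype.card_fin, Fintype.card_fin, pow_mul]
      _ ≤ _ := Finset.card_le_card hcover
      _ ≤ _ := (Finset.card_union_le _ _).trans
        (Nat.add_le_add_left (Finset.card_union_le _ _) _)
  have h2 : 2 * E.card ≤ 2 ^ (M * d) := by
    have h3 : E.card ≤ 2 ^ ((M - 1) * d) := card_filter_forall_dvd_div_le (by omega)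
    calc 2 * E.card ≤ 2 * 2 ^ ((M - 1) * d) := Nat.mul_le_mul_left _ h3
      _ = 2 ^ ((M - 1) * d + 1) := by rw [pow_succ, mul_comm]
      _ ≤ 2 ^ (M * d) := by
          refine Nat.pow_le_pow_right (by norm_num) ?_
          obtain ⟨M', rfl⟩ := Nat.exists_eq_add_of_le' hM
          rw [Nat.add_sub_cancel, Nat.add_mul, one_mul]
          omega
  have h3 : 4 * (J.biUnion F).card ≤ 2 ^ (M * d) := by
    by_cases hmM : m ≤ M
    · have h4 : (J.biUnion F).card ≤ M * 2 ^ ((M - m) * d) := by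
        refine (Finset.card_biUnion_le_card_mul J F _ fun e he => ?_).trans
          (Nat.mul_le_mul_right _ ((Finset.card_filter_le _ _).trans (Finset.card_range M).le))
        rw [hJ, Finset.mem_filter] at he
        exact card_filter_forall_dvd_div_le he.2
      calc 4 * (J.biUnion F).card ≤ 4 * (M * 2 ^ ((M - m) * d)) := Nat.mul_le_mul_left _ h4
        _ = 4 * M * 2 ^ ((M - m) * d) := by ring
        _ ≤ 2 ^ (m * d) * 2 ^ ((M - m) * d) := Nat.mul_le_mul_right _ hMm
        _ = 2 ^ (M * d) := by
            rw [← pow_add, ← Nat.add_mul]; congr 2; omega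
    · have : J = ∅ := by
        rw [hJ]
        refine Finset.filter_false_of_mem fun e _ => by omega
      rw [this]; simp
  omega

/-- The dyadic cube of level `i + q` around `x` lies in the ball of radius `2⁻¹ ^ i`. Its open
corner of relative side `2⁻¹ ^ m` consists of points whose next `m` digit vectors vanish, and these
are forbidden; the condition on `α` makes the ball fit there. -/
lemma sparseDigits_por (hd : 1 ≤ d) {m q : ℕ} (hq : √d ≤ 2 ^ q) {α : ℝ} (hα : 0 ≤ α)
    (hαm : 2 ^ (q + 1) * α < (2 : ℝ)⁻¹ ^ m) {θ ε : ℝ} (hA : (sparseDigits d M m).Nonempty)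
    (hM : 1 ≤ M)
    {x : EuclideanSpace ℝ (Fin d)} (hx : x ∈ moranSet (blockDigits (sparseDigits d M m) θ))
    {i : ℕ} (hi : IsSelected θ ((i + q) / M)) :
    α ≤ por (moranMeasure (blockDigits (sparseDigits d M m) θ) (blockDigits_nonempty hA θ)) x
      ((2 : ℝ)⁻¹ ^ i) ε := by
  obtain ⟨ω, hω, rfl⟩ := hx
  set k := (i + q) / M with hk
  set r := (i + q) % M with hr
  have hrM : r < M := Nat.mod_lt _ hM
  have hn : M * k + r = i + q := Nat.div_add_mod _ _
  obtain ⟨g, hg⟩ : ∃ g, g = M - r := ⟨_, rfl⟩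
  have hgr : r + g = M := by omega
  -- The first `r` bits of block `k`; the cube cuts this block before its last `g ≥ 1` bits.
  set u : Fin d → ℕ := fun c => (ω k c : ℕ) / 2 ^ g with hu
  set X : Fin d → ℝ := fun c => (2 ^ M) ^ k * digitPoint ω c with hX
  have h2r : (0 : ℝ) < 2 ^ r := by positivity
  have h2g : (0 : ℝ) < 2 ^ g := by positivity
  have h2m : (0 : ℝ) < 2⁻¹ ^ m := by positivity
  have h2m1 : (2 : ℝ)⁻¹ ^ m ≤ 1 := pow_le_one₀ (by norm_num) (by norm_num)
  have hrg : (2 : ℝ) ^ M = 2 ^ r * 2 ^ g := by rw [← pow_add, hgr]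
  have hscale : (2 : ℝ) ^ (i + q) = (2 ^ M) ^ k * 2 ^ r := by rw [← hn, pow_add, pow_mul]
  set z : Fin d → ℝ := fun c => digitPrefix k ω c * 2 ^ r + u c with hz
  have hu1 : ∀ c, (u c : ℝ) + 1 ≤ 2 ^ r := by
    intro c
    have h1 : u c < 2 ^ r := by
      simp only [hu]
      rw [Nat.div_lt_iff_lt_mul (by positivity), ← pow_add, hgr]
      exact (ω k c).2
    exact_mod_cast h1
  have hxz : ∀ c, z c ≤ 2 ^ (i + q) * digitPoint ω c ∧
      2 ^ (i + q) * digitPoint ω c ≤ z c + 1 := by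
    intro c
    have a1 := digitPrefix_le (k + 1) ω c
    have a2 := le_digitPrefix_add_one (k + 1) ω c
    rw [digitPrefix_succ] at a1 a2
    push_cast at a1 a2
    have a3 : ((u c * 2 ^ g : ℕ) : ℝ) ≤ (ω k c : ℕ) := by
      exact_mod_cast Nat.div_mul_le_self _ _
    have a4 : (((ω k c : ℕ) + 1 : ℕ) : ℝ) ≤ ((u c * 2 ^ g + 2 ^ g : ℕ) : ℝ) := by
      have : (ω k c : ℕ) < u c * 2 ^ g + 2 ^ g := by
        have := Nat.lt_div_mul_add (a := (ω k c : ℕ)) (show 0 < 2 ^ g by positivity)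
        exact this
      exact_mod_cast this
    push_cast at a3 a4
    have e1 : ((2 : ℝ) ^ M) ^ (k + 1) * digitPoint ω c =
        2 ^ (i + q) * digitPoint ω c * 2 ^ g := by
      rw [hscale, pow_succ]; nth_rw 2 [hrg]; ring
    have e2 : z c * 2 ^ g = digitPrefix k ω c * 2 ^ M + u c * 2 ^ g := by
      simp only [hz]; rw [hrg]; ring
    rw [e1] at a1 a2
    constructor
    · refine le_of_mul_le_mul_right ?_ h2g
      rw [e2]; linarith
    · refine le_of_mul_le_mul_right ?_ h2g
      rw [add_mul, e2]; linarith
  have hpn : (0 : ℝ) < 2 ^ (i + q) := by positivity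
  set y : EuclideanSpace ℝ (Fin d) :=
    WithLp.toLp 2 fun c => (z c + 2⁻¹ ^ m / 2) / 2 ^ (i + q) with hy
  have hball : ∀ y' ∈ Metric.closedBall y (α * 2⁻¹ ^ i), ∀ c,
      z c < 2 ^ (i + q) * y' c ∧ 2 ^ (i + q) * y' c < z c + 2⁻¹ ^ m := by
    intro y' hy' c
    have h1 := (abs_coord_sub_le_dist y' y c).trans hy'
    have h2 : |2 ^ (i + q) * y' c - (z c + 2⁻¹ ^ m / 2)| ≤ 2 ^ q * α := by
      have e1 : 2 ^ (i + q) * y' c - (z c + 2⁻¹ ^ m / 2) = 2 ^ (i + q) * (y' c - y c) := by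
        simp only [hy]; field_simp
      rw [e1, abs_mul, abs_of_pos hpn]
      calc 2 ^ (i + q) * |y' c - y c| ≤ 2 ^ (i + q) * (α * 2⁻¹ ^ i) :=
            mul_le_mul_of_nonneg_left h1 hpn.le
        _ = 2 ^ q * α := by rw [inv_pow, pow_add]; field_simp
    rw [pow_succ] at hαm
    rw [abs_le] at h2
    constructor <;> linarith [h2.1, h2.2]
  refine le_por hd (y := y) (by positivity) hα ?_ ?_
  · intro y' hy'
    have h1 : dist y' (digitPoint ω) ≤ √d * 2⁻¹ ^ (i + q) := by
      refine dist_le_sqrt_mul (by positivity) fun c => ?_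
      have h2 := hball y' hy' c
      have h3 := hxz c
      rw [inv_pow, ← one_div, le_div_iff₀ hpn, ← abs_of_pos hpn, ← abs_mul, abs_le]
      constructor <;> linarith
    refine h1.trans ?_
    calc √d * 2⁻¹ ^ (i + q) ≤ 2 ^ q * 2⁻¹ ^ (i + q) :=
          mul_le_mul_of_nonneg_right hq (by positivity)
      _ = 2⁻¹ ^ i := by rw [inv_pow, inv_pow, pow_add]; field_simp
  · refine moranMeasure_eq_zero_of_disjoint _ _ ?_
    rintro _ ⟨ω', hω', rfl⟩ hmem
    have hb := hball _ hmem
    have hpre : digitPrefix k ω' = digitPrefix k ω := by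
      refine digitPrefix_eq_of_mem_open_cube (fun c => ?_) (fun c => ?_)
      · have h1 := (hb c).1
        rw [hscale] at h1
        refine lt_of_mul_lt_mul_right ?_ h2r.le
        have : (0 : ℝ) ≤ u c := by positivity
        simp only [hz] at h1
        linarith
      · have h1 := (hb c).2
        rw [hscale] at h1
        refine lt_of_mul_lt_mul_right ?_ h2r.le
        simp only [hz] at h1
        have := hu1 c
        linarith
    have hdig : ∀ c, u c * 2 ^ g ≤ (ω' k c : ℕ) ∧
        ((ω' k c : ℕ) : ℝ) < u c * 2 ^ g + 2⁻¹ ^ m * 2 ^ g := by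
      intro c
      have a1 := digitPrefix_le (k + 1) ω' c
      have a2 := le_digitPrefix_add_one (k + 1) ω' c
      rw [digitPrefix_succ, hpre] at a1 a2
      push_cast at a1 a2
      have e1 : ((2 : ℝ) ^ M) ^ (k + 1) * digitPoint ω' c =
          2 ^ (i + q) * digitPoint ω' c * 2 ^ g := by
        rw [hscale, pow_succ]; nth_rw 2 [hrg]; ring
      have e2 : z c * 2 ^ g = digitPrefix k ω c * 2 ^ M + u c * 2 ^ g := by
        simp only [hz]; rw [hrg]; ring
      rw [e1] at a1 a2
      have b1 := mul_lt_mul_of_pos_right (hb c).1 h2g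
      have b2 := mul_lt_mul_of_pos_right (hb c).2 h2g
      rw [add_mul] at b2
      rw [e2] at b1 b2
      constructor
      · have : ((u c * 2 ^ g : ℕ) : ℝ) < ((ω' k c : ℕ) + 1 : ℕ) := by push_cast; linarith
        have : u c * 2 ^ g < (ω' k c : ℕ) + 1 := by exact_mod_cast this
        omega
      · linarith
    have hsel : ω' k ∈ sparseDigits d M m := by
      have := hω' k
      rwa [blockDigits_of_isSelected hi] at this
    obtain ⟨⟨c, hc⟩, hwin⟩ := mem_sparseDigits.1 hsel
    -- Either the zero window lies inside the block, or it runs past its end and forces the last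
    -- vector to vanish. Excluding a zero last vector handles the second case without reference to
    -- the next block.
    by_cases hgm : m ≤ g
    · obtain ⟨c, hc⟩ := hwin (g - m) (by omega)
      refine hc ?_
      obtain ⟨h1, h2⟩ := hdig c
      have e1 : (2 : ℝ)⁻¹ ^ m * 2 ^ g = 2 ^ (g - m) := by
        rw [show g = (g - m) + m by omega, pow_add, Nat.add_sub_cancel, inv_pow]; field_simp
      rw [e1] at h2
      have h2 : (ω' k c : ℕ) < u c * 2 ^ g + 2 ^ (g - m) := by exact_mod_cast h2
      have e2 : u c * 2 ^ g = u c * 2 ^ m * 2 ^ (g - m) := by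
        rw [mul_assoc, ← pow_add]; congr 2; omega
      have h3 : (ω' k c : ℕ) / 2 ^ (g - m) = u c * 2 ^ m := by
        rw [e2] at h1 h2
        refine Nat.div_eq_of_lt_le h1 ?_
        rw [Nat.add_mul, one_mul]; exact h2
      rw [h3]
      exact Dvd.intro_left _ rfl
    · refine hc ?_
      obtain ⟨h1, h2⟩ := hdig c
      have e1 : (2 : ℝ)⁻¹ ^ m * 2 ^ g ≤ 1 := by
        calc (2 : ℝ)⁻¹ ^ m * 2 ^ g ≤ 2⁻¹ ^ g * 2 ^ g :=
              mul_le_mul_of_nonneg_right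
                (pow_le_pow_of_le_one (by norm_num) (by norm_num) (by omega)) h2g.le
          _ = 1 := by rw [inv_pow]; field_simp
      have h3 : ((ω' k c : ℕ) : ℝ) < ((u c * 2 ^ g + 1 : ℕ) : ℝ) := by push_cast; linarith
      have h3 : (ω' k c : ℕ) < u c * 2 ^ g + 1 := by exact_mod_cast h3
      have h4 : (ω' k c : ℕ) = u c * 2 ^ g := by omega
      rw [h4]
      exact Dvd.dvd.mul_left (dvd_pow_self 2 (by omega)) _

/-- The digit vector of the centre of the unit cube. -/
def centralDigit (d : ℕ) (hM : 1 ≤ M) : Fin d → Fin (2 ^ M) :=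
  fun _ => ⟨2 ^ (M - 1), Nat.pow_lt_pow_right (by norm_num) (by omega)⟩

/-- In a selected block the support inside a cell is one small cluster near the centre. At the
scales considered, its relative diameter is less than `1 - 2 * α`, so a ball internally tangent to
the sphere around `x` misses it. The first two scales are skipped so that the ball around `x` does
not reach other cells. -/
lemma centralDigit_por (hd : 1 ≤ d) {l : ℕ} (hM : 4 ≤ M) {α : ℝ} (hα : 0 ≤ α) (hα1 : α ≤ 1)
    (hl : √d * (2 : ℝ)⁻¹ ^ l < 1 - 2 * α) {θ ε : ℝ}
    {x : EuclideanSpace ℝ (Fin d)}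
    (hx : x ∈ moranSet (blockDigits {centralDigit d (show 1 ≤ M by omega)} θ))
    {i : ℕ} (hi : IsSelected θ (i / M)) (hi2 : 2 ≤ i % M) (hil : i % M + l ≤ M) :
    α ≤ por (moranMeasure (blockDigits {centralDigit d (show 1 ≤ M by omega)} θ)
      (blockDigits_nonempty (Finset.singleton_nonempty _) θ)) x ((2 : ℝ)⁻¹ ^ i) ε := by
  have : Nonempty (Fin d) := ⟨⟨0, hd⟩⟩
  obtain ⟨ω, hω, rfl⟩ := hx
  set k := i / M with hk
  set r := i % M with hr
  have hn : M * k + r = i := Nat.div_add_mod _ _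
  have hρ : (0 : ℝ) < 2⁻¹ ^ i := by positivity
  obtain ⟨w, hw⟩ := exists_norm_eq (EuclideanSpace ℝ (Fin d))
    (show 0 ≤ (1 - α) * (2 : ℝ)⁻¹ ^ i from mul_nonneg (by linarith) hρ.le)
  have hyx : dist (digitPoint ω + w) (digitPoint ω) = (1 - α) * (2 : ℝ)⁻¹ ^ i := by
    rw [dist_eq_norm, add_sub_cancel_left, hw]
  have hsub : Metric.closedBall (digitPoint ω + w) (α * 2⁻¹ ^ i) ⊆
      Metric.closedBall (digitPoint ω) (2⁻¹ ^ i) := by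
    refine Metric.closedBall_subset_closedBall' ?_
    rw [hyx]; linarith
  have hdigit : ∀ ω' : ℕ → Fin d → Fin (2 ^ M),
      (∀ k, ω' k ∈ blockDigits {centralDigit d (show 1 ≤ M by omega)} θ k) →
      ω' k = centralDigit d (show 1 ≤ M by omega) := by
    intro ω' hω'
    have := hω' k
    rwa [blockDigits_of_isSelected hi, Finset.mem_singleton] at this
  refine le_por hd hρ hα hsub ?_
  refine moranMeasure_eq_zero_of_disjoint _ _ ?_
  rintro _ ⟨ω', hω', rfl⟩ hmem
  have hpre : digitPrefix k ω' = digitPrefix k ω := by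
    -- In units of the cell, the offset of `x` from the centre is at most `1/16` and the radius at
    -- most `1/4`.
    have key : ∀ c, |((2 : ℝ) ^ M) ^ k * digitPoint ω' c - (digitPrefix k ω c + 1 / 2)| < 1 / 2 := by
      intro c
      have a1 := digitPrefix_le (k + 1) ω c
      have a2 := le_digitPrefix_add_one (k + 1) ω c
      rw [digitPrefix_succ, hdigit ω hω] at a1 a2
      have e1 : (((centralDigit d (show 1 ≤ M by omega) c : ℕ) : ℤ) : ℝ) = 2 ^ M / 2 := by
        simp only [centralDigit]
        push_cast
        rw [eq_div_iff (by norm_num), ← pow_succ]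
        congr 1; omega
      push_cast at a1 a2 e1
      rw [e1, pow_succ] at a1 a2
      have hM16 : (16 : ℝ) ≤ 2 ^ M := by
        calc (16 : ℝ) = 2 ^ 4 := by norm_num
          _ ≤ 2 ^ M := pow_le_pow_right₀ (by norm_num) hM
      have hM0 : (0 : ℝ) < 2 ^ M := by positivity
      have b1 : (digitPrefix k ω c : ℝ) + 1 / 2 ≤ (2 ^ M) ^ k * digitPoint ω c := by
        refine le_of_mul_le_mul_right ?_ hM0
        linarith
      have b2 : (2 ^ M) ^ k * digitPoint ω c ≤ (digitPrefix k ω c : ℝ) + 1 / 2 + 1 / 16 := by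
        refine le_of_mul_le_mul_right ?_ hM0
        linarith
      have b3 : |(2 ^ M) ^ k * digitPoint ω' c - (2 ^ M) ^ k * digitPoint ω c| ≤ 1 / 4 := by
        have h1 := (abs_coord_sub_le_dist (digitPoint ω') (digitPoint ω) c).trans (hsub hmem)
        have p : (0 : ℝ) < (2 ^ M) ^ k := by positivity
        rw [← mul_sub, abs_mul, abs_of_pos p]
        calc (2 ^ M) ^ k * |digitPoint ω' c - digitPoint ω c| ≤ (2 ^ M) ^ k * 2⁻¹ ^ i :=
              mul_le_mul_of_nonneg_left h1 p.le
          _ = 2⁻¹ ^ r := by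
              rw [← hn, pow_add, pow_mul, ← mul_assoc, ← mul_pow, ← mul_pow]; norm_num
          _ ≤ 2⁻¹ ^ 2 := pow_le_pow_of_le_one (by norm_num) (by norm_num) hi2
          _ = 1 / 4 := by norm_num
      rw [abs_le] at b3
      rw [abs_lt]
      constructor <;> linarith [b3.1, b3.2]
    refine digitPrefix_eq_of_mem_open_cube (fun c => ?_) (fun c => ?_)
    · have := abs_lt.1 (key c); linarith [this.1]
    · have := abs_lt.1 (key c); linarith [this.2]
  have hpre' : digitPrefix (k + 1) ω' = digitPrefix (k + 1) ω := by
    funext c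
    rw [digitPrefix_succ, digitPrefix_succ, hpre, hdigit ω hω, hdigit ω' hω']
  have hdist : dist (digitPoint ω') (digitPoint ω) ≤ √d * 2⁻¹ ^ l * 2⁻¹ ^ i := by
    refine (dist_le_sqrt_mul (by positivity) fun c => abs_digitPoint_sub_le hpre' c).trans ?_
    rw [mul_assoc, ← pow_add]
    refine mul_le_mul_of_nonneg_left (pow_le_pow_of_le_one (by norm_num) (by norm_num) ?_)
      (by positivity)
    rw [Nat.mul_add, Nat.mul_one]
    omega
  have h1 : dist (digitPoint ω') (digitPoint ω + w) ≤ α * 2⁻¹ ^ i := hmem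
  have h2 := dist_triangle_left (digitPoint ω + w) (digitPoint ω) (digitPoint ω')
  rw [hyx] at h2
  have h3 := mul_lt_mul_of_pos_right hl hρ
  linarith

end Moran

lemma isMeanPorous_dirac (hd : 1 ≤ d) {α η : ℝ} (hα : 0 ≤ α) (hα1 : α < 1 / 2) (hη : η ≤ 1) :
    IsMeanPorous (Measure.dirac (0 : EuclideanSpace ℝ (Fin d))) α η := by
  have : Nonempty (Fin d) := ⟨⟨0, hd⟩⟩
  refine isMeanPorous_of_isSelected (θ := 1) (M := 1) zero_le_one le_rfl le_rfl {0} (by simp) 0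
    (by simpa using hη) _ fun ε _ => ?_
  have h0 : ∀ᵐ x ∂Measure.dirac (0 : EuclideanSpace ℝ (Fin d)), x = 0 :=
    (ae_dirac_iff (measurableSet_singleton 0)).2 rfl
  filter_upwards [h0] with x hx i _ _
  rw [hx]
  have hρ : (0 : ℝ) < 2⁻¹ ^ i := by positivity
  obtain ⟨w, hw⟩ := exists_norm_eq (EuclideanSpace ℝ (Fin d))
    (show 0 ≤ (1 - α) * (2 : ℝ)⁻¹ ^ i from mul_nonneg (by linarith) hρ.le)
  refine le_por hd (y := w) hρ hα ?_ ?_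
  · refine Metric.closedBall_subset_closedBall' ?_
    rw [dist_zero_right, hw]; linarith
  · rw [Measure.dirac_apply' _ Metric.isClosed_closedBall.measurableSet, Set.indicator_of_notMem]
    rw [Metric.mem_closedBall, dist_zero_left, hw, not_le]
    exact mul_lt_mul_of_pos_right (by linarith) hρ

lemma dim_dirac : packingDim (Measure.dirac (0 : EuclideanSpace ℝ (Fin d))) = 0 ∧
    hausdorffDim (Measure.dirac (0 : EuclideanSpace ℝ (Fin d))) = 0 := by
  have h0 : ∀ᵐ x ∂Measure.dirac (0 : EuclideanSpace ℝ (Fin d)), x = 0 :=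
    (ae_dirac_iff (measurableSet_singleton 0)).2 rfl
  have hr : logRatio (Measure.dirac (0 : EuclideanSpace ℝ (Fin d))) 0 =ᶠ[𝓝[>] (0 : ℝ)]
      fun _ => 0 := by
    filter_upwards [self_mem_nhdsWithin] with r hr
    rw [logRatio, Measure.dirac_apply_of_mem (Metric.mem_closedBall_self (le_of_lt hr)),
      ENNReal.log_one, EReal.zero_div]
  have hne : Measure.dirac (0 : EuclideanSpace ℝ (Fin d)) ≠ 0 := IsProbabilityMeasure.ne_zero _
  constructor
  · have : upperLocalDim (Measure.dirac (0 : EuclideanSpace ℝ (Fin d)))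
        =ᵐ[Measure.dirac (0 : EuclideanSpace ℝ (Fin d))] fun _ => (0 : EReal) := by
      filter_upwards [h0] with x hx
      rw [hx, upperLocalDim, limsup_congr hr, limsup_const]
    rw [packingDim, essSup_congr_ae this, essSup_const _ hne]
  · have : lowerLocalDim (Measure.dirac (0 : EuclideanSpace ℝ (Fin d)))
        =ᵐ[Measure.dirac (0 : EuclideanSpace ℝ (Fin d))] fun _ => (0 : EReal) := by
      filter_upwards [h0] with x hx
      rw [hx, lowerLocalDim, liminf_congr hr, liminf_const]
    rw [hausdorffDim, essSup_congr_ae this, essSup_const _ hne]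

end MeanPorosity

/-! ### Choice of parameters and conclusion -/

namespace MeanPorosity

variable {d : ℕ}

/-- There are mean porous measures of large dimension, for small porosity. -/
lemma exists_isMeanPorous_of_small (hd : 1 ≤ d) {α η : ℝ} (hα : 0 < α)
    (hα1 : 2 ^ (d + 4) * α ≤ 1) (hη : 0 < η) (hη1 : η ≤ 1) :
    ∃ μ : Measure (EuclideanSpace ℝ (Fin d)), IsProbabilityMeasure μ ∧ IsMeanPorous μ α η ∧
      packingDim μ = hausdorffDim μ ∧
      ((d - 8 * η * (2 ^ (d + 3) * α) ^ d : ℝ) : EReal) ≤ packingDim μ := by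
  have hlog : 0 < Real.log 2 := Real.log_pos (by norm_num)
  have hpow : ∀ j, (2 : ℝ) ^ (d + j) = 2 ^ d * 2 ^ j := fun j => pow_add 2 d j
  rw [hpow] at hα1
  have h2d : (0 : ℝ) < 2 ^ d := by positivity
  -- `2⁻¹ ^ m` is comparable to `α`, with one factor `2` to spare for `sparseDigits_por` with `q =
  -- d`.
  obtain ⟨m, hm1, hm2⟩ := exists_nat_pow_near_of_lt_one (x := 2 ^ (d + 2) * α) (y := (2 : ℝ)⁻¹)
    (by positivity) (by rw [hpow]; linarith) (by norm_num) (by norm_num)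
  have hm3 : (2 : ℝ)⁻¹ ^ m ≤ 2 ^ (d + 3) * α := by
    rw [pow_succ, hpow] at hm1
    rw [hpow]; linarith
  have hm4 : 2 ^ (d + 1) * α < (2 : ℝ)⁻¹ ^ m := by
    refine lt_of_lt_of_le ?_ hm2
    rw [hpow, hpow]
    have : 0 < 2 ^ d * α := by positivity
    linarith
  have hm : 2 ≤ m := by
    by_contra hcon
    have h1 : (2 : ℝ)⁻¹ ^ (m + 1) < 2⁻¹ ^ 2 := by
      refine hm1.trans_le ?_
      rw [hpow]
      norm_num
      linarith
    have h2 := (pow_lt_pow_iff_right_of_lt_one₀ (by norm_num : (0 : ℝ) < 2⁻¹) (by norm_num)).1 h1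
    omega
  have hmd : 2 ≤ m * d := by nlinarith
  -- The longest block allowed by `card_sparseDigits`; the loss `log 4 / (M * log 2) = 2 / M` is
  -- then `8 * 2 ^ (-m d)`.
  obtain ⟨M, hM⟩ : ∃ M, M = 2 ^ (m * d - 2) := ⟨_, rfl⟩
  have hM1 : 1 ≤ M := by rw [hM]; exact Nat.one_le_two_pow
  have h4M : 4 * M = 2 ^ (m * d) := by
    rw [hM, show 4 = 2 ^ 2 by norm_num, ← pow_add]; congr 1; omega
  have hcard := card_sparseDigits (M := M) hd (show 1 ≤ m by omega) hM1 h4M.le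
  have hA : (sparseDigits d M m).Nonempty := by
    rw [← Finset.card_pos]
    have : 0 < 2 ^ (M * d) := by positivity
    omega
  have hq : √(d : ℝ) ≤ 2 ^ d := by
    refine Real.sqrt_le_iff.2 ⟨by positivity, ?_⟩
    have h1 : (d : ℝ) ≤ 2 ^ d := by exact_mod_cast Nat.lt_two_pow_self.le
    have h2 : (1 : ℝ) ≤ 2 ^ d := one_le_pow₀ (by norm_num)
    nlinarith
  refine ⟨moranMeasure (blockDigits (sparseDigits d M m) η) (blockDigits_nonempty hA η),
    inferInstance, ?_, ?_, ?_⟩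
  · have hM0 : (0 : ℝ) < M := by exact_mod_cast hM1
    refine isMeanPorous_of_isSelected hη.le hη1 hM1 (Finset.range M)
      (fun r hr => Finset.mem_range.1 hr) d ?_ _ fun ε _ => ?_
    · rw [Finset.card_range, mul_div_cancel_left₀ _ hM0.ne']
    · filter_upwards [ae_mem_moranSet _ (blockDigits_nonempty hA η)] with x hx i hi _
      exact sparseDigits_por hd hq hα.le hm4 hA hM1 hx hi
  · rw [(dim_moranMeasure hd hM1 hA hη.le hη1).1, (dim_moranMeasure hd hM1 hA hη.le hη1).2]
  · rw [(dim_moranMeasure hd hM1 hA hη.le hη1).1, EReal.coe_le_coe_iff, moranDim]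
    have hM0 : (0 : ℝ) < M := by exact_mod_cast hM1
    have hlogA : M * d * Real.log 2 - 2 * Real.log 2 ≤ Real.log (sparseDigits d M m).card := by
      have h1 : ((2 : ℝ) ^ (M * d)) ≤ 2 ^ 2 * (sparseDigits d M m).card := by
        have : ((2 ^ (M * d) : ℕ) : ℝ) ≤ (4 * (sparseDigits d M m).card : ℕ) := by
          exact_mod_cast hcard
        push_cast at this
        linarith
      have h2 := Real.log_le_log (by positivity) h1
      rw [Real.log_mul (by norm_num) (by exact_mod_cast hA.card_pos.ne'), Real.log_pow,
        Real.log_pow] at h2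
      push_cast at h2
      linarith
    have h1 : d - Real.log (sparseDigits d M m).card / (M * Real.log 2) ≤ 2 / M := by
      rw [sub_le_iff_le_add, ← sub_le_iff_le_add', le_div_iff₀ (by positivity)]
      have : ((d : ℝ) - 2 / M) * (M * Real.log 2) = M * d * Real.log 2 - 2 * Real.log 2 := by
        field_simp
      rw [this]
      exact hlogA
    have h2 : 2 / (M : ℝ) ≤ 8 * (2 ^ (d + 3) * α) ^ d := by
      have h3 : (2 : ℝ) / M = 8 * (2⁻¹ ^ m) ^ d := by
        have : (4 : ℝ) * M = 2 ^ (m * d) := by exact_mod_cast h4M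
        rw [← pow_mul, inv_pow, ← this]
        field_simp
        norm_num
      rw [h3]
      gcongr
    have h3 := mul_le_mul_of_nonneg_left (h1.trans h2) hη.le
    linarith

/-- There are mean porous measures of large dimension, for a small proportion of porous scales. -/
lemma exists_isMeanPorous_of_half (hd : 1 ≤ d) {α η : ℝ} (hα : 0 < α) (hα1 : α < 1 / 2)
    (hη : 0 < η) (hη1 : η ≤ 1 / 2) :
    ∃ μ : Measure (EuclideanSpace ℝ (Fin d)), IsProbabilityMeasure μ ∧ IsMeanPorous μ α η ∧
      packingDim μ = hausdorffDim μ ∧ ((d - 2 * η * d : ℝ) : EReal) ≤ packingDim μ := by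
  have hd' : (1 : ℝ) ≤ d := by exact_mod_cast hd
  have hs : 1 ≤ √(d : ℝ) := Real.one_le_sqrt.2 hd'
  obtain ⟨l, hl⟩ := exists_pow_lt_of_lt_one (show 0 < (1 - 2 * α) / √d from
    div_pos (by linarith) (by linarith)) (show (2 : ℝ)⁻¹ < 1 by norm_num)
  rw [lt_div_iff₀ (by positivity), mul_comm] at hl
  have hl1 : 1 ≤ l := by
    by_contra hcon
    have : l = 0 := by omega
    rw [this, pow_zero] at hl
    linarith
  -- The usable residues `2, …, M - l` are then at least half of all, so density `2 * η` of selected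
  -- blocks suffices.
  obtain ⟨M, hM⟩ : ∃ M, M = 2 * (l + 2) := ⟨_, rfl⟩
  have hM4 : 4 ≤ M := by omega
  have hM1 : 1 ≤ M := by omega
  have hA : ({centralDigit d hM1} : Finset (Fin d → Fin (2 ^ M))).Nonempty :=
    Finset.singleton_nonempty _
  have h0 : 0 ≤ 2 * η := by linarith
  have h1 : 2 * η ≤ 1 := by linarith
  refine ⟨moranMeasure (blockDigits {centralDigit d hM1} (2 * η)) (blockDigits_nonempty hA (2 * η)),
    inferInstance, ?_, ?_, ?_⟩
  · refine isMeanPorous_of_isSelected h0 h1 hM1 (Finset.Icc 2 (M - l))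
      (fun r hr => by rw [Finset.mem_Icc] at hr; omega) 0 ?_ _ fun ε _ => ?_
    · have hM0 : (0 : ℝ) < M := by exact_mod_cast hM1
      rw [Nat.card_Icc, le_div_iff₀ hM0]
      have : (M : ℝ) ≤ 2 * ((M - l + 1 - 2 : ℕ) : ℝ) := by
        exact_mod_cast (show M ≤ 2 * (M - l + 1 - 2) by omega)
      nlinarith
    · filter_upwards [ae_mem_moranSet _ (blockDigits_nonempty hA (2 * η))] with x hx i hi hiR
      rw [add_zero] at hi hiR
      rw [Finset.mem_Icc] at hiR
      exact centralDigit_por hd hM4 hα.le (by linarith) hl hx hi hiR.1 (by omega)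
  · rw [(dim_moranMeasure hd hM1 hA h0 h1).1, (dim_moranMeasure hd hM1 hA h0 h1).2]
  · rw [(dim_moranMeasure hd hM1 hA h0 h1).1, EReal.coe_le_coe_iff, moranDim]
    simp

end MeanPorosity

end

theorem theorem1p1 (d : ℕ) (hd : 1 ≤ d) :
    (∀ (μ : Measure (EuclideanSpace ℝ (Fin d))) (_ : IsProbabilityMeasure μ) (α η : ℝ),
      0 < α → α ≤ 1 / 2 → 0 < η → η ≤ 1 → MeanPorosity.IsMeanPorous μ α η →
        MeanPorosity.packingDim μ ≤
          (((d : ℝ) - MeanPorosity.porosityConst d * η * α ^ d : ℝ) : EReal)) ∧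
    (∃ c' : ℝ, 0 < c' ∧ ∀ α η : ℝ, 0 < α → α < 1 / 2 → 0 < η → η ≤ 1 →
      ∃ μ : Measure (EuclideanSpace ℝ (Fin d)), IsProbabilityMeasure μ ∧
        MeanPorosity.IsMeanPorous μ α η ∧
        MeanPorosity.packingDim μ = MeanPorosity.hausdorffDim μ ∧
        (((d : ℝ) - c' * η * α ^ d : ℝ) : EReal) ≤ MeanPorosity.packingDim μ) := by
  have hd' : (1 : ℝ) ≤ d := by exact_mod_cast hd
  -- The factor `(2 ^ (d + 4)) ^ d` makes the subtracted term at least `8 * d * η` whenever `α` is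
  -- not small. This exceeds the loss `2 * η * d`, and it exceeds `d` when `η > 1/2`, so that the
  -- Dirac mass suffices.
  refine ⟨fun μ _ α η hα hα1 hη _ hpor =>
    MeanPorosity.packingDim_le_of_isMeanPorous hd μ hα hα1 hη hpor,
    8 * d * (2 ^ (d + 4)) ^ d, by positivity, fun α η hα hα1 hη hη1 => ?_⟩
  have hc : 8 * (d : ℝ) * (2 ^ (d + 4)) ^ d * η * α ^ d = 8 * d * η * (2 ^ (d + 4) * α) ^ d := by
    rw [mul_pow]; ring
  by_cases hsmall : 2 ^ (d + 4) * α ≤ 1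
  · obtain ⟨μ, hμ, h1, h2, h3⟩ :=
      MeanPorosity.exists_isMeanPorous_of_small hd hα hsmall hη hη1
    refine ⟨μ, hμ, h1, h2, le_trans ?_ h3⟩
    rw [EReal.coe_le_coe_iff, hc]
    have h4 : (2 ^ (d + 3) * α) ^ d ≤ (2 ^ (d + 4) * α) ^ d := by
      gcongr
      · norm_num
      · norm_num
    have h5 : 8 * η * (2 ^ (d + 3) * α) ^ d ≤ 8 * d * η * (2 ^ (d + 4) * α) ^ d := by
      have h6 : 8 * η ≤ 8 * d * η := by nlinarith
      gcongr
    linarith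
  · have hlarge : 1 ≤ (2 ^ (d + 4) * α) ^ d := one_le_pow₀ (not_le.1 hsmall).le
    have h5 : 8 * d * η ≤ 8 * d * η * (2 ^ (d + 4) * α) ^ d :=
      le_mul_of_one_le_right (by positivity) hlarge
    by_cases hhalf : η ≤ 1 / 2
    · obtain ⟨μ, hμ, h1, h2, h3⟩ :=
        MeanPorosity.exists_isMeanPorous_of_half hd hα hα1 hη hhalf
      refine ⟨μ, hμ, h1, h2, le_trans ?_ h3⟩
      rw [EReal.coe_le_coe_iff, hc]
      have : 0 ≤ d * η := by positivity
      linarith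
    · refine ⟨Measure.dirac 0, inferInstance, MeanPorosity.isMeanPorous_dirac hd hα.le hα1 hη1,
        ?_, ?_⟩
      · rw [MeanPorosity.dim_dirac.1, MeanPorosity.dim_dirac.2]
      · rw [MeanPorosity.dim_dirac.1, ← EReal.coe_zero, EReal.coe_le_coe_iff, hc]
        have : d * (1 / 2) ≤ d * η := mul_le_mul_of_nonneg_left (not_le.1 hhalf).le (by positivity)
        linarith
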